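/- Let $0<\varepsilon<\pi/2$ and $\sigma,m,\mu,\nu,\rho_1,\rho_2,\rho_3>0$, $\zeta_0\in\mathbb R$, and let $N\ge 2$ be the space dimension. For constants $\gamma_1,\gamma_3$ with $\rho_1\le\gamma_1\le\rho_2$ and $0<\gamma_3\le\rho_3$ put $\alpha=\gamma_1^{-1}\mu$ and $\beta=\gamma_1^{-1}(\nu-\mu)$. Let $\Sigma_\varepsilon=\{z\in\mathbb C\setminus\{0\}:|\arg z|\le\pi-\varepsilon\}$. The parameter $\zeta$ is of one of the following kinds, and for $\lambda_0>0$ the region $\Gamma_{\varepsilon,\lambda_0,\zeta}\subset\mathbb C$ is defined accordingly: * (C1) $\zeta=\gamma_1^{-1}\gamma_3\lambda^{-1}$ (a function of $\lambda$), and $\Gamma_{\varepsilon,\lambda_0,\zeta}=\{\lambda\in\Sigma_\varepsilon:|\lambda|\ge\lambda_0,\ (\operatorname{Re}\lambda+\rho_3/\nu+\varepsilon)^2+(\operatorname{Im}\lambda)^2\ge(\rho_3/\nu+\varepsilon)^2\}$; * (C2) $\zeta\in\Sigma_\varepsilon$ is a constant with $\operatorname{Re}\zeta<0$, $|\zeta|\le\zeta_0$,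 and $\Gamma_{\varepsilon,\lambda_0,\zeta}=\{\lambda:\operatorname{Re}\lambda\ge|\operatorname{Re}\zeta/\operatorname{Im}\zeta|\,|\operatorname{Im}\lambda|,\ \operatorname{Re}\lambda\ge\lambda_0\}$; * (C3) $\zeta$ is a constant with $\operatorname{Re}\zeta\ge0$, $|\zeta|\le\zeta_0$, and $\Gamma_{\varepsilon,\lambda_0,\zeta}=\{\lambda:\operatorname{Re}\lambda\ge\lambda_0\}$. For $\xi'\in\mathbb R^{N-1}$ let, with principal square roots, $$A=\sqrt{(2\alpha+\beta+\zeta)^{-1}\lambda+|\xi'|^2},\qquad B=\sqrt{\alpha^{-1}\lambda+|\xi'|^2},$$ and let $\mathbb L=[L_{ij}]_{2\times2}$ be the Lopatinski matrix $$L_{11}=\frac{\alpha A(B^2-|\xi'|^2)}{AB-|\xi'|^2},\quad L_{12}=\frac{\alpha|\xi'|^2(2AB-|\xi'|^2-B^2)}{AB-|\xi'|^2},$$ $$L_{21}=\frac{2\alpha A(B-A)-(\beta+\zeta)(A^2-|\xi'|^2)}{AB-|\xi'|^2},\quad L_{22}=\frac{(2\alpha+\beta+\zeta)B(A^2-|\xi'|^2)}{AB-|\xi'|^2}.$$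 Set $N(A,B)=\lambda\det\mathbb L+\sigma L_{11}(m+|\xi'|^2)$ and $\tau=\operatorname{Im}\lambda$. Then there are $\lambda_0\ge1$ and $c>0$, depending only on $\sigma,m,\varepsilon,\mu,\nu,\zeta_0,\rho_1,\rho_2,\rho_3$, and for every multi-index $\kappa'\in\mathbb N_0^{N-1}$ a constant $C_{\kappa'}>0$, depending only on these quantities and on $\kappa'$ (hence on $N$), such that for all $\gamma_1,\gamma_3,\zeta$ as above, all $\lambda\in\Gamma_{\varepsilon,\lambda_0,\zeta}$, all $\xi'\in\mathbb R^{N-1}\setminus\{0\}$ and $\ell=0,1$: $$|N(A,B)|\ge c\,(|\lambda|+|\xi'|)(|\lambda|^{1/2}+|\xi'|)^2,$$ the function $(\lambda,\xi')\mapsto N(A,B)^{-1}$ is smooth (in the real sense) near $(\lambda,\xi')$, and $$\big|\partial_{\xi'}^{\kappa'}(\tau\partial_\tau)^\ell\big(N(A,B)^{-1}\big)\big|\le C_{\kappa'}(|\lambda|+|\xi'|)^{-1}(|\lambda|^{1/2}+|\xi'|)^{-2-|\kappa'|}.$$ -/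

import Mathlib

open scoped ContDiff

noncomputable section

/-! Throughout, `lam` is the resolvent parameter `λ`, `ξ` is the tangential frequency `ξ'`, and
`α = μ / γ₁`, `β = (ν - μ) / γ₁`. -/

/-- The sector `Σ_ε = {z ≠ 0 : |arg z| ≤ π - ε}`. -/
def sectorSet (ε : ℝ) : Set ℂ := {z | z ≠ 0 ∧ |z.arg| ≤ Real.pi - ε}

/-- The truncated sector `Σ_{ε,λ₀} = {z ∈ Σ_ε : |z| ≥ λ₀}`. -/
def truncSector (ε lam₀ : ℝ) : Set ℂ := {z | z ∈ sectorSet ε ∧ lam₀ ≤ ‖z‖}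

/-- The region `Λ_{ε,λ₀}`: the truncated sector minus an open disc that touches the origin
from the left. -/
def regionLambda (ν ρ₃ ε lam₀ : ℝ) : Set ℂ :=
  {z | z ∈ truncSector ε lam₀ ∧
    (ρ₃ / ν + ε) ^ 2 ≤ (z.re + ρ₃ / ν + ε) ^ 2 + z.im ^ 2}

/-- The two kinds of parameter `ζ`: the one that depends on `λ` (case C1), and a fixed complex
number (cases C2 and C3). -/
inductive ZetaParam where
  | recip : ZetaParam
  | const (ζ : ℂ) : ZetaParam

namespace ZetaParam

/-- The value of `ζ` at `λ`: it is `γ₁⁻¹ γ₃ λ⁻¹` in case (C1), and constant otherwise. -/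
def val (γ₁ γ₃ : ℝ) : ZetaParam → ℂ → ℂ
  | recip, lam => (γ₁ : ℂ)⁻¹ * (γ₃ : ℂ) * lam⁻¹
  | const ζ, _ => ζ

/-- A constant `ζ` satisfies `|ζ| ≤ ζ₀` and either (C2) `ζ ∈ Σ_ε`, `Re ζ < 0`,
or (C3) `Re ζ ≥ 0`. -/
def Admissible (ε ζ₀ : ℝ) : ZetaParam → Prop
  | recip => True
  | const ζ => ‖ζ‖ ≤ ζ₀ ∧ ((ζ ∈ sectorSet ε ∧ ζ.re < 0) ∨ 0 ≤ ζ.re)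

open Classical in
/-- The region `Γ_{ε,λ₀,ζ}` in the cases (C1), (C2) (`Re ζ < 0`) and (C3) (`Re ζ ≥ 0`). -/
def region (ν ρ₃ ε lam₀ : ℝ) : ZetaParam → Set ℂ
  | recip => regionLambda ν ρ₃ ε lam₀
  | const ζ =>
      if ζ.re < 0 then {lam | |ζ.re / ζ.im| * |lam.im| ≤ lam.re ∧ lam₀ ≤ lam.re}
      else {lam | lam₀ ≤ lam.re}

end ZetaParam

section Symbols

variable {d : ℕ} (α β : ℝ) (ζ lam : ℂ) (ξ : EuclideanSpace ℝ (Fin d))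

/-- `|ξ'|²` as a complex number. -/
def xiSq : ℂ := ((‖ξ‖ ^ 2 : ℝ) : ℂ)

/-- `A = √((2α+β+ζ)⁻¹ λ + |ξ'|²)`, principal branch. -/
def symbA : ℂ := ((2 * α + β + ζ)⁻¹ * lam + xiSq ξ) ^ (1 / 2 : ℂ)

/-- `B = √(α⁻¹ λ + |ξ'|²)`, principal branch. -/
def symbB : ℂ := ((α : ℂ)⁻¹ * lam + xiSq ξ) ^ (1 / 2 : ℂ)

/-- The Lopatinski matrix `𝕃`. -/
def lopatinski : Matrix (Fin 2) (Fin 2) ℂ :=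
  let A := symbA α β ζ lam ξ
  let B := symbB α lam ξ
  let s := xiSq ξ
  !![α * A * (B ^ 2 - s) / (A * B - s),
     α * s * (2 * A * B - s - B ^ 2) / (A * B - s);
     (2 * α * A * (B - A) - (β + ζ) * (A ^ 2 - s)) / (A * B - s),
     (2 * α + β + ζ) * B * (A ^ 2 - s) / (A * B - s)]

/-- `N(A,B) = λ det 𝕃 + σ L₁₁ (m + |ξ'|²)`. -/
def symbN (σ m : ℝ) : ℂ :=
  lam * (lopatinski α β ζ lam ξ).det + σ * lopatinski α β ζ lam ξ 0 0 * (m + xiSq ξ)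

end Symbols

/-- `N(A,B)` as a function of `(λ, ξ')`, with `α = γ₁⁻¹ μ`, `β = γ₁⁻¹ (ν - μ)`, and with the
(possibly `λ`-dependent) parameter `ζ` inserted. -/
def symbNAB (σ m μ ν γ₁ γ₃ : ℝ) (Z : ZetaParam) {d : ℕ} (lam : ℂ)
    (ξ : EuclideanSpace ℝ (Fin d)) : ℂ :=
  symbN (γ₁⁻¹ * μ) (γ₁⁻¹ * (ν - μ)) (Z.val γ₁ γ₃ lam) lam ξ σ m

/-- The operator `τ ∂_τ`, where `τ = Im λ` and `Re λ` is kept fixed. -/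
def tauDeriv (F : ℂ → ℂ) (lam : ℂ) : ℂ :=
  lam.im * deriv (fun τ : ℝ => F (lam.re + τ * Complex.I)) lam.im

/-- The partial derivative `∂^κ f (ξ)` for a multi-index `κ`: the derivative of order `|κ|`,
evaluated on the family that contains the `j`-th standard basis vector `κ j` times. -/
def multiDeriv {d : ℕ} (κ : Fin d → ℕ) (f : EuclideanSpace ℝ (Fin d) → ℂ)
    (ξ : EuclideanSpace ℝ (Fin d)) : ℂ :=
  iteratedFDeriv ℝ (∑ j, κ j) f ξ
    (fun i => EuclideanSpace.single (finSigmaFinEquiv.symm i).1 (1 : ℝ))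

end

/-!
A zero of the Rayleigh function `(B² + w)² - 4 w A B`, with `w = |ξ'|²`, would give a solution of
the resolvent system `λ u = α Δ u + κ ∇ div u` on a half-space, with `κ = α + β + ζ`, that decays in
the normal direction and has no traction at the boundary. Its energy identity is a vanishing sum
with nonnegative weights of `λ`, `α` and `κ`, which is impossible when these lie in a common
half-plane; the conditions on `ζ` and `λ` ensure that they do.

Once the removable singularity at `λ = 0` has been divided out, `N(A, B)` is holomorphic in the two
complex variables `λ` and `w`. It is not homogeneous, but replacing the factors `λ`, `1` and `m` of
its terms by independent variables makes it so; as `|λ| → ∞` the rescaled variables approach a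
compact set on which the symbol does not vanish. By compactness the lower bound holds, uniformly in
the parameters, on complex polydiscs with radii comparable to `|λ|` and `(|λ|^{1/2} + |ξ'|)²`, and
the derivative estimates are Cauchy estimates on these polydiscs: `τ ∂_τ` is `d / dx` along
`τ = τ₀ eˣ`, and the `ξ'`-derivatives follow by the chain rule for `w = |ξ'|²`.
-/

open ComplexConjugate Filter Topology Metric Set MeasureTheory

noncomputable section

/-! ### The energy identity on the half-line -/

/-- The squared norm in `L²(0, ∞)` of the function `x ↦ f e^{-ax} + g e^{-bx}`. -/
def expNormSq (a b f g : ℂ) : ℝ :=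
  ∫ x : ℝ in Ioi 0, ‖f * Complex.exp (-a * x) + g * Complex.exp (-b * x)‖ ^ 2

lemma expNormSq_nonneg (a b f g : ℂ) : 0 ≤ expNormSq a b f g :=
  integral_nonneg fun _ => sq_nonneg _

lemma conj_exp_neg_mul_ofReal (a : ℂ) (x : ℝ) :
    conj (Complex.exp (-a * x)) = Complex.exp (-conj a * x) := by
  rw [← Complex.exp_conj, map_mul, map_neg, Complex.conj_ofReal]

lemma ofReal_expNormSq {a b : ℂ} (ha : 0 < a.re) (hb : 0 < b.re) (f g : ℂ) :
    (expNormSq a b f g : ℂ) = f * conj f / (a + conj a) + f * conj g / (a + conj b)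
      + g * conj f / (b + conj a) + g * conj g / (b + conj b) := by
  have re_neg {c e : ℂ} (hc : 0 < c.re) (he : 0 < e.re) : (-(c + conj e)).re < 0 := by
    simp only [Complex.neg_re, Complex.add_re, Complex.conj_re]; linarith
  have int (u : ℂ) {c e : ℂ} (hc : 0 < c.re) (he : 0 < e.re) :
      IntegrableOn (fun x : ℝ => u * Complex.exp (-(c + conj e) * x)) (Ioi 0) :=
    (integrableOn_exp_mul_complex_Ioi (re_neg hc he) 0).const_mul u
  have integral_eq (u : ℂ) {c e : ℂ} (hc : 0 < c.re) (he : 0 < e.re) :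
      ∫ x : ℝ in Ioi 0, u * Complex.exp (-(c + conj e) * x) = u / (c + conj e) := by
    rw [integral_const_mul, integral_exp_mul_complex_Ioi (re_neg hc he)]
    simp [div_eq_mul_inv, neg_inv]
  have expand (x : ℝ) :
      ((‖f * Complex.exp (-a * x) + g * Complex.exp (-b * x)‖ ^ 2 : ℝ) : ℂ) =
        f * conj f * Complex.exp (-(a + conj a) * x) + f * conj g * Complex.exp (-(a + conj b) * x)
          + g * conj f * Complex.exp (-(b + conj a) * x)
          + g * conj g * Complex.exp (-(b + conj b) * x) := by
    push_cast
    rw [← Complex.mul_conj']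
    simp only [map_add, map_mul, conj_exp_neg_mul_ofReal, neg_add, add_mul, Complex.exp_add]
    ring
  rw [expNormSq, ← integral_complex_ofReal]
  simp only [expand]
  rw [integral_add (((int _ ha ha).fun_add (int _ ha hb)).fun_add (int _ hb ha)) (int _ hb hb),
    integral_add ((int _ ha ha).fun_add (int _ ha hb)) (int _ hb ha),
    integral_add (int _ ha ha) (int _ ha hb), integral_eq _ ha ha, integral_eq _ ha hb,
    integral_eq _ hb ha, integral_eq _ hb hb]

lemma expNormSq_pos {a b f : ℂ} (ha : 0 < a.re) (hb : 0 < b.re) (hf : f ≠ 0) :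
    0 < expNormSq a b f 0 := by
  have h : expNormSq a b f 0 = ‖f‖ ^ 2 / (2 * a.re) := by
    have := ofReal_expNormSq ha hb f 0
    simp only [map_zero, mul_zero, zero_mul, zero_div, add_zero, Complex.mul_conj',
      Complex.add_conj] at this
    exact_mod_cast this
  rw [h]
  positivity

section Modes

variable (r : ℝ) (a v w : ℂ)

/-- The divergence of the field `(v, w) e^{i r y - a x}`, up to the exponential factor. Here `y` is
the tangential variable and `x > 0` the normal one. -/
def modeDiv : ℂ := Complex.I * r * v - a * w

/-- The difference `∂_y v - ∂_x w` for the field `(v, w) e^{i r y - a x}`, up to the exponential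
factor. -/
def modeStretch : ℂ := Complex.I * r * v + a * w

/-- The shear `∂_x v + ∂_y w` of the field `(v, w) e^{i r y - a x}`, up to the exponential
factor. -/
def modeShear : ℂ := -(a * v) + Complex.I * r * w

/-- The field `(v, w) e^{i r y - a x}` solves the resolvent system `lam u = α Δ u + κ ∇ div u`. -/
structure IsMode (α κ lam : ℂ) : Prop where
  tangential : lam * v = α * (a ^ 2 - r ^ 2) * v + κ * (Complex.I * r) * modeDiv r a v w
  normal : lam * w = α * (a ^ 2 - r ^ 2) * w - κ * a * modeDiv r a v w

end Modes

/-- Testing a mode against `(V, W) e^{i r y - c x}`: the right-hand side is the boundary term, in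
which `α` times the shear and `κ` times the divergence minus `α` times the stretch are the
components of the traction. -/
lemma IsMode.energy {α κ lam a v w : ℂ} {r : ℝ} (h : IsMode r a v w α κ lam) {c : ℂ}
    (hac : a + c ≠ 0) (V W : ℂ) :
    lam * (v * V / (a + c) + w * W / (a + c))
      + α * (modeStretch r a v w * (-(Complex.I * r * V) + c * W) / (a + c)
        + modeShear r a v w * (-(c * V) - Complex.I * r * W) / (a + c))
      + κ * (modeDiv r a v w * (-(Complex.I * r * V) - c * W) / (a + c))
    = -(α * modeShear r a v w * V + (κ * modeDiv r a v w - α * modeStretch r a v w) * W) := by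
  have h₁ := h.tangential
  have h₂ := h.normal
  simp only [modeDiv, modeStretch, modeShear] at h₁ h₂ ⊢
  field_simp
  linear_combination V * h₁ + W * h₂ - α * r ^ 2 * (v * V + w * W) * Complex.I_sq

lemma add_conj_ne_zero {a b : ℂ} (ha : 0 < a.re) (hb : 0 < b.re) : a + conj b ≠ 0 := fun h => by
  have := congrArg Complex.re h
  simp only [Complex.add_re, Complex.conj_re, Complex.zero_re] at this
  linarith

lemma energy_eq_zero_of_traction_eq_zero {α κ lam a v₁ w₁ b v₂ w₂ : ℂ} {r : ℝ}
    (ha : 0 < a.re) (hb : 0 < b.re)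
    (h₁ : IsMode r a v₁ w₁ α κ lam) (h₂ : IsMode r b v₂ w₂ α κ lam)
    (tangential : α * (modeShear r a v₁ w₁ + modeShear r b v₂ w₂) = 0)
    (normal : κ * (modeDiv r a v₁ w₁ + modeDiv r b v₂ w₂)
      - α * (modeStretch r a v₁ w₁ + modeStretch r b v₂ w₂) = 0) :
    lam * (expNormSq a b v₁ v₂ + expNormSq a b w₁ w₂)
      + α * (expNormSq a b (modeStretch r a v₁ w₁) (modeStretch r b v₂ w₂)
        + expNormSq a b (modeShear r a v₁ w₁) (modeShear r b v₂ w₂))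
      + κ * expNormSq a b (modeDiv r a v₁ w₁) (modeDiv r b v₂ w₂) = 0 := by
  have e₁₁ := h₁.energy (add_conj_ne_zero ha ha) (conj v₁) (conj w₁)
  have e₁₂ := h₁.energy (add_conj_ne_zero ha hb) (conj v₂) (conj w₂)
  have e₂₁ := h₂.energy (add_conj_ne_zero hb ha) (conj v₁) (conj w₁)
  have e₂₂ := h₂.energy (add_conj_ne_zero hb hb) (conj v₂) (conj w₂)
  simp only [ofReal_expNormSq ha hb]
  simp only [modeDiv, modeStretch, modeShear, map_add, map_sub, map_mul, map_neg, Complex.conj_I,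
    Complex.conj_ofReal] at *
  linear_combination e₁₁ + e₁₂ + e₂₁ + e₂₂ - (conj v₁ + conj v₂) * tangential
    - (conj w₁ + conj w₂) * normal

lemma isMode_longitudinal {α κ lam a : ℂ} {r : ℝ} (h : lam = (α + κ) * (a ^ 2 - r ^ 2)) (p : ℂ) :
    IsMode r a (Complex.I * r * p) (-(a * p)) α κ lam where
  tangential := by
    rw [modeDiv]
    linear_combination Complex.I * r * p * h - Complex.I * r ^ 3 * p * κ * Complex.I_sq
  normal := by
    rw [modeDiv]
    linear_combination - a * p * h + a * p * r ^ 2 * κ * Complex.I_sq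

lemma isMode_transverse {α lam b : ℂ} {r : ℝ} (h : lam = α * (b ^ 2 - r ^ 2)) (κ q : ℂ) :
    IsMode r b (b * q) (Complex.I * r * q) α κ lam where
  tangential := by rw [modeDiv]; linear_combination b * q * h
  normal := by rw [modeDiv]; linear_combination Complex.I * r * q * h

/-- A zero of the Rayleigh function gives a superposition of a longitudinal and a transverse mode
without traction at the boundary, whose energy balance is impossible in a half-plane. -/
lemma rayleigh_ne_zero {α r : ℝ} {κ lam χ A B : ℂ} (hα : 0 < α) (hlam : lam ≠ 0)
    (hχ : 0 < χ.re) (hχl : 0 ≤ (χ * lam).re) (hχκ : 0 < (χ * κ).re)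
    (hA : lam = (α + κ) * (A ^ 2 - r ^ 2)) (hB : lam = α * (B ^ 2 - r ^ 2))
    (hAre : 0 < A.re) (hBre : 0 < B.re) :
    (B ^ 2 + r ^ 2) ^ 2 - 4 * r ^ 2 * A * B ≠ 0 := by
  intro hR
  have hB0 : B ≠ 0 := by rintro rfl; simp at hBre
  rcases eq_or_ne r 0 with rfl | hr
  · simp [hB0] at hR
  set p : ℂ := 2 * Complex.I * r * B with hp
  set q : ℂ := B ^ 2 + r ^ 2
  have hp0 : p ≠ 0 := by simp [hp, hB0, hr]
  have div_transverse : modeDiv r B (B * q) (Complex.I * r * q) = 0 := by rw [modeDiv]; ring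
  have div_longitudinal :
      modeDiv r A (Complex.I * r * p) (-(A * p)) = (A ^ 2 - r ^ 2) * p := by
    rw [modeDiv]; linear_combination r ^ 2 * p * Complex.I_sq
  have energy := energy_eq_zero_of_traction_eq_zero hAre hBre (isMode_longitudinal hA p)
    (isMode_transverse hB κ q)
    (by
      simp only [modeShear]
      linear_combination -α * hR - (4 * α * r ^ 2 * A * B - α * r ^ 2 * q) * Complex.I_sq)
    (by
      rw [div_transverse, div_longitudinal, modeStretch, modeStretch]
      linear_combination p * (hB - hA) - α * r ^ 2 * p * Complex.I_sq)
  rw [div_transverse, div_longitudinal] at energy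
  have hpos : 0 < expNormSq A B ((A ^ 2 - r ^ 2) * p) 0 :=
    expNormSq_pos hAre hBre (mul_ne_zero (right_ne_zero_of_mul (hA ▸ hlam)) hp0)
  set E := expNormSq A B
  have hre := congrArg (fun u => (χ * u).re) energy
  simp only [mul_add, Complex.add_re, mul_left_comm χ (α : ℂ), ← mul_assoc χ, Complex.re_mul_ofReal,
    Complex.re_ofReal_mul, mul_zero, Complex.zero_re] at hre
  have := mul_pos hχκ hpos
  have := mul_nonneg hχl (expNormSq_nonneg A B (Complex.I * r * p) (B * q))
  have := mul_nonneg hχl (expNormSq_nonneg A B (-(A * p)) (Complex.I * r * q))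
  have h₃ := mul_nonneg hα.le (mul_nonneg hχ.le (expNormSq_nonneg A B
    (modeStretch r A (Complex.I * r * p) (-(A * p))) (modeStretch r B (B * q) (Complex.I * r * q))))
  have h₄ := mul_nonneg hα.le (mul_nonneg hχ.le (expNormSq_nonneg A B
    (modeShear r A (Complex.I * r * p) (-(A * p))) (modeShear r B (B * q) (Complex.I * r * q))))
  linarith

/-! ### The desingularised symbol -/

/-- The principal root `√(E⁻¹ z + w)`: with `z = λ` and `w = |ξ'|²` it is `A` for `E = α + κ` and
`B` for `E = α`, where `κ = α + β + ζ`. -/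
def rootSymb (E z w : ℂ) : ℂ := (E⁻¹ * z + w) ^ (1 / 2 : ℂ)

/-- The Rayleigh function divided by `z`, that is `α² ((B² + w)² - 4 w A B) / z`, in a form that is
regular at `z = 0`. -/
def rayleighQuot (α κ z w : ℂ) : ℂ :=
  z + 4 * w * α - 4 * α * w * (z + (2 * α + κ) * w) /
    ((α + κ) * (rootSymb (α + κ) z w * rootSymb α z w + w))

/-- The factor `z / (A B - w)` of the Lopatinski determinant, in a form that is regular at
`z = 0`. -/
def lopFactor (α κ z w : ℂ) : ℂ :=
  α * (α + κ) * (rootSymb (α + κ) z w * rootSymb α z w + w) / (z + (2 * α + κ) * w)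

/-- The symbol `N(A, B)` in which the factors `λ`, `1` and `m` of its terms are replaced by
independent variables `l`, `r` and `e`. This makes it homogeneous in several scales. -/
def weightedSymb (σ : ℝ) (α κ z w l r e : ℂ) : ℂ :=
  lopFactor α κ z w * (l * rayleighQuot α κ z w + σ * r * rootSymb (α + κ) z w * (e + w))

/-- The denominators of the symbols do not vanish, and the radicands avoid the branch cut. -/
structure Regular (α κ z w : ℂ) : Prop where
  add_ne_zero : α + κ ≠ 0
  left_ne_zero : α ≠ 0
  slitA : (α + κ)⁻¹ * z + w ∈ Complex.slitPlane
  slitB : α⁻¹ * z + w ∈ Complex.slitPlane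
  den_ne_zero : z + (2 * α + κ) * w ≠ 0
  prod_ne_zero : rootSymb (α + κ) z w * rootSymb α z w + w ≠ 0

/-- `1` and `κ` lie in an open half-plane with `0` on its boundary, whose closure contains `θ`. -/
def HalfPlane (κ θ : ℂ) : Prop := ∃ χ : ℂ, 0 < χ.re ∧ 0 ≤ (χ * θ).re ∧ 0 < (χ * κ).re

lemma HalfPlane.ofReal_mul {κ θ : ℂ} (h : HalfPlane κ θ) {x : ℝ} (hx : 0 ≤ x) :
    HalfPlane κ (x * θ) := by
  obtain ⟨χ, h₁, hθ, hκ⟩ := h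
  refine ⟨χ, h₁, ?_, hκ⟩
  rw [mul_left_comm, Complex.re_ofReal_mul]
  positivity

lemma HalfPlane.ne_zero {κ θ : ℂ} (h : HalfPlane κ θ) : κ ≠ 0 := by
  obtain ⟨χ, -, -, hκ⟩ := h
  rintro rfl
  simp at hκ

lemma re_rootSymb_pos {E z w : ℂ} (hs : E⁻¹ * z + w ∈ Complex.slitPlane) :
    0 < (rootSymb E z w).re := by
  rw [rootSymb]
  set u := E⁻¹ * z + w
  obtain ⟨harg, h₀⟩ := Complex.mem_slitPlane_iff_arg.1 hs
  have hlt : u.arg < Real.pi := lt_of_le_of_ne (Complex.arg_le_pi u) harg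
  have him : (Complex.log u * (1 / 2)).im = u.arg / 2 := by
    simp [div_eq_mul_inv, Complex.log_im]
  rw [Complex.cpow_def_of_ne_zero h₀, Complex.exp_re, him]
  have := Complex.neg_pi_lt_arg u
  exact mul_pos (Real.exp_pos _) (Real.cos_pos_of_mem_Ioo ⟨by linarith, by linarith⟩)

lemma rootSymb_sq (E z w : ℂ) : rootSymb E z w ^ 2 = E⁻¹ * z + w := by simp [rootSymb]

lemma mul_rootSymb_sq_sub {E : ℂ} (hE : E ≠ 0) (z w : ℂ) :
    E * (rootSymb E z w ^ 2 - w) = z := by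
  rw [rootSymb_sq]; field_simp; ring

lemma rootSymb_zero_sq (E w : ℂ) : rootSymb E 0 w ^ 2 = w := by simp [rootSymb_sq]

lemma rootSymb_zero_eq (E E' w : ℂ) : rootSymb E 0 w = rootSymb E' 0 w := by simp [rootSymb]

lemma mem_slitPlane_of_halfPlane {χ E z : ℂ} (hE : 0 < (χ * E).re) (hz : 0 ≤ (χ * z).re) {y : ℝ}
    (hy : 0 ≤ y) (hzy : z ≠ 0 ∨ y ≠ 0) : E⁻¹ * z + y ∈ Complex.slitPlane := by
  have hE0 : E ≠ 0 := by rintro rfl; simp at hE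
  rw [Complex.mem_slitPlane_iff_not_le_zero]
  intro hle
  obtain ⟨t, ht⟩ : ∃ t : ℝ, (t : ℂ) = E⁻¹ * z + y :=
    ⟨_, Complex.ext rfl (by simpa using (Complex.le_def.1 hle).2.symm)⟩
  have ht0 : t ≤ 0 := by rw [← ht] at hle; exact_mod_cast hle
  have hzE : z = (t - y : ℝ) * E := by push_cast; rw [ht]; field_simp; ring
  have hre : 0 ≤ (t - y) * (χ * E).re := by
    rwa [hzE, mul_left_comm, Complex.re_ofReal_mul] at hz
  have hty : 0 ≤ t - y := nonneg_of_mul_nonneg_left hre hE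
  obtain rfl : y = 0 := by linarith
  obtain rfl : t = 0 := by linarith
  simp [hzE] at hzy

lemma rootSymb_mul_sub_mul_add {α κ z w : ℂ} (hD : α + κ ≠ 0) (hα : α ≠ 0) :
    α * (α + κ) * ((rootSymb (α + κ) z w * rootSymb α z w - w) *
      (rootSymb (α + κ) z w * rootSymb α z w + w)) = z * (z + (2 * α + κ) * w) := by
  have h : (rootSymb (α + κ) z w * rootSymb α z w - w) *
      (rootSymb (α + κ) z w * rootSymb α z w + w) =
      ((α + κ)⁻¹ * z + w) * (α⁻¹ * z + w) - w ^ 2 := by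
    rw [← rootSymb_sq (α + κ), ← rootSymb_sq α]; ring
  rw [h]
  field_simp
  ring

lemma HalfPlane.regular {α : ℝ} (hα : 0 < α) {κ z : ℂ} (h : HalfPlane κ z) {y : ℝ} (hy : 0 ≤ y)
    (hzy : z ≠ 0 ∨ y ≠ 0) : Regular α κ z y := by
  obtain ⟨χ, h₁, hz, hκ⟩ := h
  have hχα : 0 < (χ * α).re := by rw [Complex.re_mul_ofReal]; positivity
  have hχD : 0 < (χ * (α + κ)).re := by rw [mul_add, Complex.add_re]; positivity
  have hD : (α : ℂ) + κ ≠ 0 := by intro h; simp [h] at hχD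
  have hα0 : (α : ℂ) ≠ 0 := by exact_mod_cast hα.ne'
  have hχE : 0 < (χ * (2 * α + κ)).re := by
    rw [show χ * (2 * α + κ) = χ * α + χ * (α + κ) by ring, Complex.add_re]; positivity
  have den : z + (2 * α + κ) * y ≠ 0 := by
    have hE0 : 2 * (α : ℂ) + κ ≠ 0 := by intro h; simp [h] at hχE
    have := Complex.slitPlane_ne_zero (mem_slitPlane_of_halfPlane hχE hz hy hzy)
    contrapose! this
    field_simp
    linear_combination this
  refine ⟨hD, hα0, mem_slitPlane_of_halfPlane hχD hz hy hzy,
    mem_slitPlane_of_halfPlane hχα hz hy hzy, den, fun h₀ => ?_⟩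
  have hz0 : z = 0 := by
    simpa [h₀, den] using rootSymb_mul_sub_mul_add (z := z) (w := y) hD hα0
  subst hz0
  rw [rootSymb_zero_eq _ α, ← pow_two, rootSymb_zero_sq, ← two_mul] at h₀
  simp_all

lemma Regular.lopFactor_ne_zero {α κ z w : ℂ} (h : Regular α κ z w) : lopFactor α κ z w ≠ 0 :=
  div_ne_zero (mul_ne_zero (mul_ne_zero h.left_ne_zero h.add_ne_zero) h.prod_ne_zero) h.den_ne_zero

lemma Regular.mul_rayleighQuot {α κ z w : ℂ} (h : Regular α κ z w) :
    z * rayleighQuot α κ z w = α ^ 2 * ((rootSymb α z w ^ 2 + w) ^ 2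
      - 4 * w * rootSymb (α + κ) z w * rootSymb α z w) := by
  have hα := h.left_ne_zero
  have hD := h.add_ne_zero
  have hP := h.prod_ne_zero
  have hz := mul_rootSymb_sq_sub hα z w
  have hquot : z * (z + (2 * α + κ) * w) /
      ((α + κ) * (rootSymb (α + κ) z w * rootSymb α z w + w))
      = α * (rootSymb (α + κ) z w * rootSymb α z w - w) := by
    rw [← rootSymb_mul_sub_mul_add hD hα]; field_simp
  calc z * rayleighQuot α κ z w
      = z ^ 2 + 4 * w * α * z - 4 * α * w * (z * (z + (2 * α + κ) * w) /
          ((α + κ) * (rootSymb (α + κ) z w * rootSymb α z w + w))) := by rw [rayleighQuot]; ring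
    _ = (α * (rootSymb α z w ^ 2 - w)) ^ 2 + 4 * w * α * (α * (rootSymb α z w ^ 2 - w))
          - 4 * α * w * (α * (rootSymb (α + κ) z w * rootSymb α z w - w)) := by rw [hquot, hz]
    _ = _ := by ring

lemma rayleighQuot_zero {α κ w : ℂ} (hD : α + κ ≠ 0) (hw : w ≠ 0) :
    rayleighQuot α κ 0 w = 2 * α * κ * w / (α + κ) := by
  rw [rayleighQuot, rootSymb_zero_eq _ α, ← pow_two, rootSymb_zero_sq]
  field_simp
  ring

lemma HalfPlane.rayleighQuot_ne_zero {α : ℝ} (hα : 0 < α) {κ z : ℂ} (h : HalfPlane κ z) {y : ℝ}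
    (hy : 0 ≤ y) (hzy : z ≠ 0 ∨ y ≠ 0) : rayleighQuot α κ z y ≠ 0 := by
  have hreg := h.regular hα hy hzy
  have hα0 := hreg.left_ne_zero
  have hD := hreg.add_ne_zero
  rcases eq_or_ne z 0 with rfl | hz
  · have hy0 : (y : ℂ) ≠ 0 := by simpa using hzy
    rw [rayleighQuot_zero hD hy0]
    simp [hα0, hD, h.ne_zero, hy0]
  obtain ⟨χ, h₁, hχz, hχκ⟩ := h
  have hs : ((√y : ℝ) : ℂ) ^ 2 = y := by exact_mod_cast Real.sq_sqrt hy
  have hR := rayleigh_ne_zero (r := √y) hα hz h₁ hχz hχκ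
    (by rw [hs, mul_rootSymb_sq_sub hD z y]) (by rw [hs, mul_rootSymb_sq_sub hα0 z y])
    (re_rootSymb_pos hreg.slitA) (re_rootSymb_pos hreg.slitB)
  rw [hs] at hR
  exact right_ne_zero_of_mul (hreg.mul_rayleighQuot ▸ mul_ne_zero (pow_ne_zero 2 hα0) hR)

/-- The conditions on `α`, `κ = α + β + ζ` and a direction `θ` of the resolvent parameter under
which the principal parts of the symbol do not vanish. -/
structure IsElliptic (α : ℝ) (κ θ : ℂ) : Prop where
  pos : 0 < α
  norm_eq_one : ‖θ‖ = 1
  halfPlane : HalfPlane κ θ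
  halfPlane_conj : HalfPlane (conj κ) θ

lemma IsElliptic.ne_zero {α : ℝ} {κ θ : ℂ} (h : IsElliptic α κ θ) : θ ≠ 0 :=
  norm_ne_zero_iff.1 (h.norm_eq_one ▸ one_ne_zero)

lemma IsElliptic.regular {α : ℝ} {κ θ : ℂ} (h : IsElliptic α κ θ) {x : ℝ} (hx : x ∈ Icc 0 1) :
    Regular α κ (x * θ) (1 - x) := by
  have := (h.halfPlane.ofReal_mul hx.1).regular h.pos (sub_nonneg.2 hx.2) (by
    rcases eq_or_ne x 0 with rfl | hx0
    · simp
    · simp [hx0, h.ne_zero])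
  exact_mod_cast this

lemma IsElliptic.rayleighQuot_ne_zero {α : ℝ} {κ θ : ℂ} (h : IsElliptic α κ θ) {x : ℝ}
    (hx : x ∈ Icc 0 1) : rayleighQuot α κ (x * θ) (1 - x) ≠ 0 := by
  have := (h.halfPlane.ofReal_mul hx.1).rayleighQuot_ne_zero h.pos (sub_nonneg.2 hx.2) (by
    rcases eq_or_ne x 0 with rfl | hx0
    · simp
    · simp [hx0, h.ne_zero])
  exact_mod_cast this

/-- After multiplication by `χ (α + κ) / κ` all the terms lie in a half-plane. -/
lemma IsElliptic.mul_rayleighQuot_zero_one_add_ne_zero {σ α : ℝ} {κ θ : ℂ} (hσ : 0 < σ)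
    (h : IsElliptic α κ θ) {y : ℝ} (hy : y ∈ Ico 0 1) :
    y * θ * rayleighQuot α κ 0 1 + σ * (1 - y) ≠ 0 := by
  obtain ⟨χ, h₁, hχθ, hχκ⟩ := h.halfPlane_conj
  have hκ := h.halfPlane.ne_zero
  have hD : (α : ℂ) + κ ≠ 0 := by simpa using (h.regular (x := 0) (by simp)).add_ne_zero
  rw [rayleighQuot_zero hD one_ne_zero]
  intro h₀
  have hsum : ((2 * α * y : ℝ) : ℂ) * (χ * θ) + (σ * (1 - y) : ℝ) * (χ + α * (χ * κ⁻¹)) = 0 := by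
    push_cast
    field_simp at h₀ ⊢
    linear_combination χ * h₀
  have hχκ' : 0 < (χ * κ⁻¹).re := by
    rw [Complex.inv_def, ← mul_assoc, Complex.re_mul_ofReal]
    exact mul_pos hχκ (inv_pos.2 (Complex.normSq_pos.2 hκ))
  have hre := congrArg Complex.re hsum
  simp only [Complex.add_re, Complex.re_ofReal_mul, Complex.zero_re] at hre
  have hα := h.pos
  have hy0 := hy.1
  have hy1 := sub_pos.2 hy.2
  have : 0 ≤ 2 * α * y * (χ * θ).re := by positivity
  have : 0 < σ * (1 - y) * (χ.re + α * (χ * κ⁻¹).re) := by positivity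
  linarith

lemma IsElliptic.weightedSymb_ne_zero {σ α : ℝ} {κ θ : ℂ} (hσ : 0 < σ) (h : IsElliptic α κ θ)
    {x y : ℝ} (hx : x ∈ Icc 0 1) (hy : y ∈ Icc 0 1) (hxy : x = 0 ∨ y = 1) :
    weightedSymb σ α κ (x * θ) (1 - x) (y * θ) (1 - y) 0 ≠ 0 := by
  refine mul_ne_zero (h.regular hx).lopFactor_ne_zero ?_
  rcases hy.2.eq_or_lt with rfl | hy1
  · simpa using ⟨h.ne_zero, h.rayleighQuot_ne_zero hx⟩
  obtain rfl : x = 0 := hxy.resolve_right hy1.ne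
  simpa [rootSymb] using h.mul_rayleighQuot_zero_one_add_ne_zero hσ ⟨hy.1, hy1⟩

section Analytic

variable {E : Type*} [NormedAddCommGroup E] [NormedSpace ℂ E]

lemma analyticAt_rootSymb {f z w : E → ℂ} {x : E} (hf : AnalyticAt ℂ f x) (hz : AnalyticAt ℂ z x)
    (hw : AnalyticAt ℂ w x) (h₀ : f x ≠ 0) (hs : (f x)⁻¹ * z x + w x ∈ Complex.slitPlane) :
    AnalyticAt ℂ (fun p => rootSymb (f p) (z p) (w p)) x :=
  (((hf.inv h₀).mul hz).add hw).cpow analyticAt_const hs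

namespace Regular

variable {α κ z w : E → ℂ} {x : E} (hα : AnalyticAt ℂ α x) (hκ : AnalyticAt ℂ κ x)
  (hz : AnalyticAt ℂ z x) (hw : AnalyticAt ℂ w x) (h : Regular (α x) (κ x) (z x) (w x))

include hα hκ hz hw h

lemma analyticAt_rootA : AnalyticAt ℂ (fun p => rootSymb (α p + κ p) (z p) (w p)) x :=
  analyticAt_rootSymb (hα.add hκ) hz hw h.add_ne_zero h.slitA

omit hκ in
lemma analyticAt_rootB : AnalyticAt ℂ (fun p => rootSymb (α p) (z p) (w p)) x :=
  analyticAt_rootSymb hα hz hw h.left_ne_zero h.slitB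

lemma analyticAt_lopFactor : AnalyticAt ℂ (fun p => lopFactor (α p) (κ p) (z p) (w p)) x := by
  have hA := analyticAt_rootA hα hκ hz hw h
  have hB := analyticAt_rootB hα hz hw h
  exact AnalyticAt.div (by fun_prop) (by fun_prop) h.den_ne_zero

lemma analyticAt_rayleighQuot :
    AnalyticAt ℂ (fun p => rayleighQuot (α p) (κ p) (z p) (w p)) x := by
  have hA := analyticAt_rootA hα hκ hz hw h
  have hB := analyticAt_rootB hα hz hw h
  refine AnalyticAt.sub (by fun_prop) (AnalyticAt.div (by fun_prop) (by fun_prop) ?_)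
  exact mul_ne_zero h.add_ne_zero h.prod_ne_zero

lemma analyticAt_weightedSymb (σ : ℝ) {l r e : E → ℂ} (hl : AnalyticAt ℂ l x)
    (hr : AnalyticAt ℂ r x) (he : AnalyticAt ℂ e x) :
    AnalyticAt ℂ (fun p => weightedSymb σ (α p) (κ p) (z p) (w p) (l p) (r p) (e p)) x := by
  have hA := analyticAt_rootA hα hκ hz hw h
  have hL := analyticAt_lopFactor hα hκ hz hw h
  have hQ := analyticAt_rayleighQuot hα hκ hz hw h
  unfold weightedSymb
  fun_prop

lemma eventually : ∀ᶠ p in 𝓝 x, Regular (α p) (κ p) (z p) (w p) := by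
  have cα := hα.continuousAt
  have cκ := hκ.continuousAt
  have cz := hz.continuousAt
  have cw := hw.continuousAt
  have cA := (analyticAt_rootA hα hκ hz hw h).continuousAt
  have cB := (analyticAt_rootB hα hz hw h).continuousAt
  have slit {E : E → ℂ} (cE : ContinuousAt E x) (hE : E x ≠ 0)
      (hs : (E x)⁻¹ * z x + w x ∈ Complex.slitPlane) :
      ∀ᶠ p in 𝓝 x, (E p)⁻¹ * z p + w p ∈ Complex.slitPlane :=
    (((cE.inv₀ hE).mul cz).add cw).eventually_mem (Complex.isOpen_slitPlane.mem_nhds hs)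
  filter_upwards [(cα.add cκ).eventually_ne h.add_ne_zero, cα.eventually_ne h.left_ne_zero,
    slit (cα.add cκ) h.add_ne_zero h.slitA, slit cα h.left_ne_zero h.slitB,
    ContinuousAt.eventually_ne (g := fun p => z p + (2 * α p + κ p) * w p) (by fun_prop)
      h.den_ne_zero,
    ((cA.mul cB).add cw).eventually_ne h.prod_ne_zero] with p h₁ h₂ h₃ h₄ h₅ h₆
  exact ⟨h₁, h₂, h₃, h₄, h₅, h₆⟩

end Regular

end Analytic

/-! ### Uniform lower bounds by compactness -/

lemma exists_le_norm_near_compact {X F : Type*} [PseudoMetricSpace X] [ProperSpace X]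
    [NormedAddCommGroup F] {K U : Set X} (hK : IsCompact K) (hU : IsOpen U) (hKU : K ⊆ U)
    {f : X → F} (hf : ContinuousOn f U) (h₀ : ∀ p ∈ U, f p ≠ 0) :
    ∃ δ > 0, ∃ c > 0, ∀ p ∈ K, ∀ q, dist q p ≤ δ → q ∈ U ∧ c ≤ ‖f q‖ := by
  obtain ⟨δ, hδ, hsub⟩ := hK.exists_cthickening_subset_open hU hKU
  obtain ⟨c, hc, hle⟩ := hK.cthickening.exists_forall_le' (hf.norm.mono hsub) (a := 0)
    fun p hp => norm_pos_iff.2 (h₀ p (hsub hp))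
  refine ⟨δ, hδ, c, hc, fun p hp q hq => ?_⟩
  have hmem := mem_cthickening_of_dist_le q p δ K hp hq
  exact ⟨hsub hmem, hle q hmem⟩

/-- `weightedSymb` as a function on `ℂ⁷`. -/
def weightedSymbFun (σ : ℝ) (p : Fin 7 → ℂ) : ℂ :=
  weightedSymb σ (p 0) (p 1) (p 2) (p 3) (p 4) (p 5) (p 6)

lemma analyticAt_coord {n : ℕ} (i : Fin n) (p : Fin n → ℂ) :
    AnalyticAt ℂ (fun q : Fin n → ℂ => q i) p :=
  (ContinuousLinearMap.proj (R := ℂ) (φ := fun _ : Fin n => ℂ) i).analyticAt p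

lemma analyticAt_weightedSymbFun (σ : ℝ) {p : Fin 7 → ℂ} (h : Regular (p 0) (p 1) (p 2) (p 3)) :
    AnalyticAt ℂ (weightedSymbFun σ) p :=
  Regular.analyticAt_weightedSymb (analyticAt_coord 0 p) (analyticAt_coord 1 p)
    (analyticAt_coord 2 p) (analyticAt_coord 3 p) h σ (analyticAt_coord 4 p)
    (analyticAt_coord 5 p) (analyticAt_coord 6 p)

lemma isOpen_regular_weightedSymbFun_ne_zero (σ : ℝ) :
    IsOpen {p : Fin 7 → ℂ | Regular (p 0) (p 1) (p 2) (p 3) ∧ weightedSymbFun σ p ≠ 0} :=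
  isOpen_iff_mem_nhds.2 fun p hp =>
    (Regular.eventually (analyticAt_coord 0 p) (analyticAt_coord 1 p) (analyticAt_coord 2 p)
      (analyticAt_coord 3 p) hp.1).and
      ((analyticAt_weightedSymbFun σ hp.1).continuousAt.eventually_ne hp.2)

/-- The pairs of limits of `λ / (|λ| + |ξ'|²)` and `λ / (|λ| + (|λ| + |ξ'|²)^{1/2})` in modulus as
`|λ| → ∞`: the second one can differ from `1` only if the first one vanishes. -/
def limitRatios : Set (ℝ × ℝ) := Icc 0 1 ×ˢ Icc 0 1 ∩ {p | p.1 = 0 ∨ p.2 = 1}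

lemma isCompact_limitRatios : IsCompact limitRatios :=
  (isCompact_Icc.prod isCompact_Icc).inter_right
    ((isClosed_eq continuous_fst continuous_const).union
      (isClosed_eq continuous_snd continuous_const))

lemma exists_mem_limitRatios_near {x y η : ℝ} (hx : x ∈ Icc 0 1) (hy : y ∈ Icc 0 1) (hη : 0 ≤ η)
    (h : x * (1 - y) ≤ η ^ 2) : ∃ p ∈ limitRatios, |x - p.1| ≤ η ∧ |y - p.2| ≤ η := by
  rcases le_or_gt x η with hxη | hxη
  · exact ⟨(0, y), ⟨⟨by simp, hy⟩, Or.inl rfl⟩, by simpa [abs_of_nonneg hx.1], by simpa⟩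
  · have hyη : 1 - y ≤ η := by
      by_contra! hlt
      nlinarith
    refine ⟨(x, 1), ⟨⟨hx, by simp⟩, Or.inr rfl⟩, by simpa, ?_⟩
    rwa [abs_sub_comm, abs_of_nonneg (sub_nonneg.2 hy.2)]

/-- The arguments of `weightedSymb` that belong to `(α, κ, θ)` and to the limit ratios `(x, y)`. -/
def limitPoint (p : (ℝ × ℂ × ℂ) × ℝ × ℝ) : Fin 7 → ℂ :=
  ![p.1.1, p.1.2.1, p.2.1 * p.1.2.2, 1 - p.2.1, p.2.2 * p.1.2.2, 1 - p.2.2, 0]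

lemma continuous_limitPoint : Continuous limitPoint := by
  unfold limitPoint
  fun_prop

lemma dist_limitPoint_le {δ : ℝ} {α x y : ℝ} {κ₀ θ κ z w l r e : ℂ}
    (hκ : ‖κ - κ₀‖ ≤ δ) (hz : ‖z - x * θ‖ ≤ δ) (hw : ‖w - (1 - x)‖ ≤ δ)
    (hl : ‖l - y * θ‖ ≤ δ) (hr : ‖r - (1 - y)‖ ≤ δ) (he : ‖e‖ ≤ δ) :
    dist ![(α : ℂ), κ, z, w, l, r, e] (limitPoint ((α, κ₀, θ), x, y)) ≤ δ := by
  have hδ : 0 ≤ δ := (norm_nonneg e).trans he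
  refine (dist_pi_le_iff hδ).2 fun i => ?_
  rw [dist_eq_norm]
  fin_cases i
  · simpa [limitPoint] using hδ
  · exact hκ
  · exact hz
  · exact hw
  · exact hl
  · exact hr
  · simpa [limitPoint] using he

lemma exists_weightedSymb_lower_bound {K : Set (ℝ × ℂ × ℂ)} (hK : IsCompact K)
    (hell : ∀ q ∈ K, IsElliptic q.1 q.2.1 q.2.2) {σ : ℝ} (hσ : 0 < σ) :
    ∃ δ > 0, ∃ c > 0, ∀ (α : ℝ) (κ₀ θ : ℂ), (α, κ₀, θ) ∈ K → ∀ x y : ℝ, (x, y) ∈ limitRatios →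
      ∀ κ z w l r e : ℂ, ‖κ - κ₀‖ ≤ δ → ‖z - x * θ‖ ≤ δ → ‖w - (1 - x)‖ ≤ δ →
        ‖l - y * θ‖ ≤ δ → ‖r - (1 - y)‖ ≤ δ → ‖e‖ ≤ δ →
        Regular α κ z w ∧ c ≤ ‖weightedSymb σ α κ z w l r e‖ := by
  have hsub : limitPoint '' (K ×ˢ limitRatios) ⊆
      {p | Regular (p 0) (p 1) (p 2) (p 3) ∧ weightedSymbFun σ p ≠ 0} := by
    rintro _ ⟨⟨q, x, y⟩, ⟨hq, ⟨hx, hy⟩, hxy⟩, rfl⟩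
    exact ⟨(hell q hq).regular hx, (hell q hq).weightedSymb_ne_zero hσ hx hy hxy⟩
  obtain ⟨δ, hδ, c, hc, H⟩ := exists_le_norm_near_compact
    ((hK.prod isCompact_limitRatios).image continuous_limitPoint)
    (isOpen_regular_weightedSymbFun_ne_zero σ) hsub
    (fun p hp => (analyticAt_weightedSymbFun σ hp.1).continuousAt.continuousWithinAt)
    fun p hp => hp.2
  refine ⟨δ, hδ, c, hc, fun α κ₀ θ hq x y hxy κ z w l r e hκ hz hw hl hr he => ?_⟩
  obtain ⟨⟨hreg, -⟩, hle⟩ := H _ (mem_image_of_mem _ (mk_mem_prod hq hxy)) _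
    (dist_limitPoint_le hκ hz hw hl hr he)
  exact ⟨hreg, hle⟩

/-- The symbol `N(A, B)` as a function of the complex variables `z = λ` and `w = |ξ'|²`, with
`κ = α + β + ζ`. -/
def symbHol (σ m : ℝ) (α κ z w : ℂ) : ℂ := weightedSymb σ α κ z w z 1 m

section Scaling

variable {t : ℝ} (ht : 0 < t) (α κ z w : ℂ)

include ht

lemma rootSymb_scale : rootSymb α (t * z) (t * w) = √t * rootSymb α z w := by
  have hsqrt : (t : ℂ) ^ (1 / 2 : ℂ) = √t := by
    rw [Real.sqrt_eq_rpow, Complex.ofReal_cpow ht.le]; norm_num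
  have hlin : α⁻¹ * (t * z) + t * w = (t : ℂ) * (α⁻¹ * z + w) := by ring
  have ht₀ : (t : ℂ) ≠ 0 := by exact_mod_cast ht.ne'
  rw [rootSymb, hlin, ← hsqrt, rootSymb]
  rcases eq_or_ne (α⁻¹ * z + w) 0 with h₀ | h₀
  · simp [h₀]
  · rw [Complex.cpow_def_of_ne_zero (mul_ne_zero ht₀ h₀), Complex.cpow_def_of_ne_zero ht₀,
      Complex.cpow_def_of_ne_zero h₀, Complex.log_ofReal_mul ht h₀, Complex.ofReal_log ht.le,
      add_mul, Complex.exp_add]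

lemma rootSymb_mul_add_scale :
    rootSymb (α + κ) (t * z) (t * w) * rootSymb α (t * z) (t * w) + t * w
      = t * (rootSymb (α + κ) z w * rootSymb α z w + w) := by
  have hsqrt : (√t : ℂ) * √t = t := by exact_mod_cast Real.mul_self_sqrt ht.le
  rw [rootSymb_scale ht, rootSymb_scale ht]
  linear_combination rootSymb (α + κ) z w * rootSymb α z w * hsqrt

lemma lopFactor_scale : lopFactor α κ (t * z) (t * w) = lopFactor α κ z w := by
  have ht₀ : (t : ℂ) ≠ 0 := by exact_mod_cast ht.ne'
  rw [lopFactor, rootSymb_mul_add_scale ht, lopFactor, mul_left_comm _ (t : ℂ) w, ← mul_add,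
    mul_left_comm _ (t : ℂ), mul_div_mul_left _ _ ht₀]

lemma rayleighQuot_scale : rayleighQuot α κ (t * z) (t * w) = t * rayleighQuot α κ z w := by
  have ht₀ : (t : ℂ) ≠ 0 := by exact_mod_cast ht.ne'
  rw [rayleighQuot, rootSymb_mul_add_scale ht, rayleighQuot, mul_left_comm (2 * α + κ) (t : ℂ) w,
    ← mul_add, mul_left_comm _ (t : ℂ) (z + _), mul_left_comm (α + κ) (t : ℂ),
    mul_div_mul_left _ _ ht₀]
  ring

lemma Regular.scale (h : Regular α κ z w) : Regular α κ (t * z) (t * w) := by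
  have ht₀ : (t : ℂ) ≠ 0 := by exact_mod_cast ht.ne'
  have slit {E : ℂ} (hs : E⁻¹ * z + w ∈ Complex.slitPlane) :
      E⁻¹ * (t * z) + t * w ∈ Complex.slitPlane := by
    rw [mul_left_comm, ← mul_add]
    simpa only [Complex.mem_slitPlane_iff, Complex.re_ofReal_mul, Complex.im_ofReal_mul,
      mul_pos_iff_of_pos_left ht, ne_eq, mul_eq_zero, ht.ne', false_or] using hs
  refine ⟨h.add_ne_zero, h.left_ne_zero, slit h.slitA, slit h.slitB, ?_, ?_⟩
  · rw [mul_left_comm, ← mul_add]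
    exact mul_ne_zero ht₀ h.den_ne_zero
  · rw [rootSymb_mul_add_scale ht]
    exact mul_ne_zero ht₀ h.prod_ne_zero

lemma symbHol_scale {h : ℝ} (hh : h ≠ 0) (σ m : ℝ) :
    symbHol σ m α κ (t * z) (t * w) =
      t * h * weightedSymb σ α κ z w (t * z / h) (√t / h : ℝ) (m / t : ℝ) := by
  have ht₀ : (t : ℂ) ≠ 0 := by exact_mod_cast ht.ne'
  have hh₀ : (h : ℂ) ≠ 0 := by exact_mod_cast hh
  rw [symbHol, weightedSymb, lopFactor_scale ht, rayleighQuot_scale ht, rootSymb_scale ht,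
    weightedSymb]
  push_cast
  field_simp

end Scaling

lemma div_mul_one_sub_div_le {L t : ℝ} (hL : 0 < L) (hLt : L ≤ t) :
    L / t * (1 - L / (L + √t)) ≤ 1 / √L := by
  have ht : 0 < t := hL.trans_le hLt
  have hst := Real.sqrt_pos.2 ht
  have : 0 < √L := Real.sqrt_pos.2 hL
  have heq : L / t * (1 - L / (L + √t)) = L / (L + √t) * (1 / √t) := by
    have := Real.mul_self_sqrt ht.le
    field_simp
    linear_combination this
  have hle : L / (L + √t) ≤ 1 := (div_le_one (by positivity)).2 (by linarith)
  calc L / t * (1 - L / (L + √t)) = L / (L + √t) * (1 / √t) := heq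
    _ ≤ 1 * (1 / √L) := by gcongr
    _ = 1 / √L := one_mul _

lemma norm_div_sub_ofReal_mul_le {z θ : ℂ} (hθ : ‖θ‖ = 1) {L t x d e : ℝ} (ht : 0 < t)
    (hz : ‖z - L * θ‖ ≤ d * t) (hx : |L / t - x| ≤ e) : ‖z / t - x * θ‖ ≤ d + e := by
  have heq : z / t - x * θ = (z - L * θ) / t + (L / t - x : ℝ) * θ := by push_cast; ring
  rw [heq]
  refine (norm_add_le _ _).trans (add_le_add ?_ ?_)
  · rwa [norm_div, Complex.norm_of_nonneg ht.le, div_le_iff₀ ht]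
  · rwa [norm_mul, hθ, mul_one, Complex.norm_real, Real.norm_eq_abs]

lemma exists_mem_limitRatios_approx {L s t h η : ℝ} (hL : 0 < L) (hs : 0 ≤ s) (ht : t = L + s)
    (hh : h = L + √t) (hη : 0 ≤ η) (hηL : 1 / √L ≤ η ^ 2) :
    ∃ p ∈ limitRatios, |L / t - p.1| ≤ η ∧ |s / t - (1 - p.1)| ≤ η ∧
      |L / h - p.2| ≤ η ∧ |√t / h - (1 - p.2)| ≤ η := by
  have hLt : L ≤ t := by linarith
  have ht0 : 0 < t := hL.trans_le hLt
  have hLh : L ≤ h := by linarith [Real.sqrt_nonneg t]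
  have hh0 : 0 < h := hL.trans_le hLh
  obtain ⟨⟨x, y⟩, hxy, hx, hy⟩ := exists_mem_limitRatios_near (x := L / t) (y := L / h)
    ⟨by positivity, (div_le_one ht0).2 hLt⟩ ⟨by positivity, (div_le_one hh0).2 hLh⟩
    hη ((hh ▸ div_mul_one_sub_div_le hL hLt).trans hηL)
  have hst : s / t - (1 - x) = -(L / t - x) := by rw [ht]; field_simp; ring
  have hsqrt : √t / h - (1 - y) = -(L / h - y) := by rw [hh]; field_simp; ring
  exact ⟨(x, y), hxy, hx, by rwa [hst, abs_neg], hy, by rwa [hsqrt, abs_neg]⟩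

lemma eventually_one_div_sqrt_le_and_div_le (m : ℝ) {δ η : ℝ} (hδ : 0 < δ) (hη : 0 < η) :
    ∀ᶠ L : ℝ in atTop, 1 / √L ≤ η ∧ m / L ≤ δ :=
  ((tendsto_const_nhds.div_atTop Real.tendsto_sqrt_atTop).eventually_le_const hη).and
    ((tendsto_const_nhds.div_atTop tendsto_id).eventually_le_const hδ)

/-- With `t = L + s` and `h = L + √t`, the point `(L / t, L / h)` is close to `limitRatios` and
`symbHol` is `t h` times `weightedSymb` near the corresponding limit point. -/
lemma exists_symbHol_lower_bound_add {K : Set (ℝ × ℂ × ℂ)} (hK : IsCompact K)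
    (hell : ∀ q ∈ K, IsElliptic q.1 q.2.1 q.2.2) {σ : ℝ} (hσ : 0 < σ) (m : ℝ) :
    ∃ δ > 0, ∃ c > 0, ∃ lam₀ ≥ 1, ∀ (α : ℝ) (κ₀ θ : ℂ), (α, κ₀, θ) ∈ K →
      ∀ L s : ℝ, lam₀ ≤ L → 0 ≤ s →
      ∀ κ z w : ℂ, ‖κ - κ₀‖ ≤ δ → ‖z - L * θ‖ ≤ δ * L → ‖w - s‖ ≤ δ * (L + s) →
        Regular α κ z w ∧ c * ((L + s) * (L + √(L + s))) ≤ ‖symbHol σ m α κ z w‖ := by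
  obtain ⟨δ, hδ, c, hc, H⟩ := exists_weightedSymb_lower_bound hK hell hσ
  obtain ⟨lam₀, hlam₀⟩ := eventually_atTop.1
    (eventually_one_div_sqrt_le_and_div_le |m| hδ (η := (δ / 2) ^ 2) (by positivity))
  refine ⟨δ / 2, by positivity, c, hc, max 1 lam₀, le_max_left _ _,
    fun α κ₀ θ hq L s hL hs κ z w hκ hz hw => ?_⟩
  obtain ⟨hη, hmL⟩ := hlam₀ L ((le_max_right _ _).trans hL)
  have hL0 : 0 < L := one_pos.trans_le ((le_max_left _ _).trans hL)
  have hθ := (hell _ hq).norm_eq_one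
  obtain ⟨t, ht⟩ : ∃ t, t = L + s := ⟨_, rfl⟩
  obtain ⟨h, hh⟩ : ∃ h, h = L + √t := ⟨_, rfl⟩
  rw [← ht] at hw ⊢
  rw [← hh]
  have hLt : L ≤ t := by linarith
  have hLh : L ≤ h := by linarith [Real.sqrt_nonneg t]
  have ht0 : 0 < t := hL0.trans_le hLt
  have hh0 : 0 < h := hL0.trans_le hLh
  have htC : (t : ℂ) ≠ 0 := by exact_mod_cast ht0.ne'
  obtain ⟨⟨x, y⟩, hxy, hx, hs', hy, hr⟩ :=
    exists_mem_limitRatios_approx hL0 hs ht hh (half_pos hδ).le hη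
  have hδ₂ : δ / 2 + δ / 2 ≤ δ := (add_halves δ).le
  have hz₁ : ‖z / t - x * θ‖ ≤ δ :=
    (norm_div_sub_ofReal_mul_le hθ ht0 (hz.trans (by gcongr)) hx).trans hδ₂
  have hz₂ : ‖z / h - y * θ‖ ≤ δ :=
    (norm_div_sub_ofReal_mul_le hθ hh0 (hz.trans (by gcongr)) hy).trans hδ₂
  have hw' : ‖w / t - (1 - x)‖ ≤ δ := by
    have hsum := norm_div_sub_ofReal_mul_le norm_one ht0 (by rwa [mul_one]) hs'
    rw [mul_one, Complex.ofReal_sub, Complex.ofReal_one] at hsum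
    exact hsum.trans hδ₂
  have hr' : ‖((√t / h : ℝ) : ℂ) - (1 - y)‖ ≤ δ := by
    rw [← Complex.ofReal_one, ← Complex.ofReal_sub, ← Complex.ofReal_sub, Complex.norm_real,
      Real.norm_eq_abs]
    linarith
  have hm' : ‖((m / t : ℝ) : ℂ)‖ ≤ δ := by
    rw [Complex.norm_real, Real.norm_eq_abs, abs_div, abs_of_pos ht0]
    exact (div_le_div_of_nonneg_left (abs_nonneg m) hL0 hLt).trans hmL
  obtain ⟨hreg, hle⟩ := H α κ₀ θ hq x y hxy κ (z / t) (w / t) (z / h) _ _ (by linarith)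
    hz₁ hw' hz₂ hr' hm'
  have hscale := symbHol_scale ht0 α κ (z / t) (w / t) hh0.ne' σ m
  rw [mul_div_cancel₀ _ htC, mul_div_cancel₀ _ htC] at hscale
  refine ⟨by simpa [mul_div_cancel₀ _ htC] using hreg.scale ht0, ?_⟩
  rw [hscale, norm_mul, norm_mul, Complex.norm_of_nonneg ht0.le, Complex.norm_of_nonneg hh0.le,
    mul_comm]
  gcongr

lemma sqrt_add_sq_le {L r : ℝ} (hL : 0 ≤ L) : (√L + r) ^ 2 ≤ 2 * (L + r ^ 2) := by
  nlinarith [Real.sq_sqrt hL, sq_nonneg (√L - r)]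

/-- `L` and `r` stand for the moduli of `λ` and `ξ'`. -/
theorem exists_symbHol_lower_bound {K : Set (ℝ × ℂ × ℂ)} (hK : IsCompact K)
    (hell : ∀ q ∈ K, IsElliptic q.1 q.2.1 q.2.2) {σ : ℝ} (hσ : 0 < σ) (m : ℝ) :
    ∃ δ > 0, ∃ c > 0, ∃ lam₀ ≥ 1, ∀ (α : ℝ) (κ₀ θ : ℂ), (α, κ₀, θ) ∈ K →
      ∀ L r : ℝ, lam₀ ≤ L →
      ∀ κ z w : ℂ, ‖κ - κ₀‖ ≤ δ → ‖z - L * θ‖ ≤ δ * L → ‖w - (r ^ 2 : ℝ)‖ ≤ δ * (√L + r) ^ 2 →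
        Regular α κ z w ∧ c * ((L + r) * (√L + r) ^ 2) ≤ ‖symbHol σ m α κ z w‖ := by
  obtain ⟨δ, hδ, c, hc, lam₀, hlam₀, H⟩ := exists_symbHol_lower_bound_add hK hell hσ m
  refine ⟨δ / 2, by positivity, c / 2, by positivity, lam₀, hlam₀,
    fun α κ₀ θ hq L r hL κ z w hκ hz hw => ?_⟩
  have hL0 : 0 ≤ L := zero_le_one.trans (hlam₀.trans hL)
  have hsq : (√L + r) ^ 2 ≤ 2 * (L + r ^ 2) := sqrt_add_sq_le hL0
  have hr' : r ≤ √(L + r ^ 2) := Real.le_sqrt_of_sq_le (by linarith)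
  obtain ⟨hreg, hle⟩ := H α κ₀ θ hq L (r ^ 2) hL (sq_nonneg r) κ z w (by linarith)
    (hz.trans (by gcongr; linarith)) (hw.trans (by nlinarith))
  refine ⟨hreg, le_trans ?_ hle⟩
  calc c / 2 * ((L + r) * (√L + r) ^ 2)
      ≤ c / 2 * ((L + √(L + r ^ 2)) * (2 * (L + r ^ 2))) := by gcongr
    _ = c * ((L + r ^ 2) * (L + √(L + r ^ 2))) := by ring

/-! ### Cauchy estimates -/

lemma iteratedDeriv_comp_ofReal {g : ℂ → ℂ} {U : Set ℂ} (hU : IsOpen U) (hg : AnalyticOnNhd ℂ g U)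
    (n : ℕ) {x : ℝ} (hx : (x : ℂ) ∈ U) :
    iteratedDeriv n (fun y : ℝ => g y) x = iteratedDeriv n g x := by
  induction n generalizing x with
  | zero => simp
  | succ n ih =>
    have hnear : iteratedDeriv n (fun y : ℝ => g y) =ᶠ[𝓝 x] fun y : ℝ => iteratedDeriv n g y := by
      filter_upwards [Complex.continuous_ofReal.continuousAt.eventually_mem (hU.mem_nhds hx)]
        with y hy using ih hy
    have hd : DifferentiableAt ℂ (iteratedDeriv n g) x := by
      rw [iteratedDeriv_eq_iterate]
      exact ((hg x hx).iterated_deriv n).differentiableAt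
    rw [iteratedDeriv_succ, iteratedDeriv_succ, hnear.deriv_eq]
    exact hd.hasDerivAt.comp_ofReal.deriv

lemma norm_iteratedDeriv_le_of_ball {g : ℂ → ℂ} {c : ℂ} {R M : ℝ} (hR : 0 < R)
    (hg : AnalyticOnNhd ℂ g (ball c R)) (hM : ∀ u ∈ ball c R, ‖g u‖ ≤ M) (n : ℕ) :
    ‖iteratedDeriv n g c‖ ≤ n.factorial * M * (2 / R) ^ n := by
  have hsub : closedBall c (R / 2) ⊆ ball c R := closedBall_subset_ball (by linarith)
  refine (Complex.norm_iteratedDeriv_le_of_forall_mem_sphere_norm_le n (half_pos hR)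
    (hg.differentiableOn.diffContOnCl_ball hsub)
    fun u hu => hM u (hsub (sphere_subset_closedBall hu))).trans_eq ?_
  rw [div_pow, div_pow]
  field_simp

section RealComposition

variable {V : Type*} [NormedAddCommGroup V]

lemma norm_iteratedFDeriv_comp_ofReal_le [NormedSpace ℝ V] {g : ℂ → ℂ} {f : V → ℝ} {ξ : V}
    {δ M D : ℝ} {n : ℕ} (hδ : 0 < δ) (hδ₂ : δ ≤ 2) (hg : AnalyticOnNhd ℂ g (ball (f ξ) δ))
    (hM : ∀ u ∈ ball (f ξ : ℂ) δ, ‖g u‖ ≤ M) (hf : ContDiff ℝ n f)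
    (hD : ∀ i ≤ n, ‖iteratedFDeriv ℝ i f ξ‖ ≤ D ^ i) :
    ‖iteratedFDeriv ℝ n (fun η => g (f η)) ξ‖ ≤
      n.factorial * (n.factorial * M * (2 / δ) ^ n) * D ^ n := by
  have hM0 : 0 ≤ M := (norm_nonneg _).trans (hM _ (mem_ball_self hδ))
  set T : Set ℝ := Complex.ofReal ⁻¹' ball (f ξ : ℂ) δ
  have hT : IsOpen T := isOpen_ball.preimage Complex.continuous_ofReal
  have hS : IsOpen (f ⁻¹' T) := hT.preimage hf.continuous
  have hξ : ξ ∈ f ⁻¹' T := mem_ball_self hδ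
  have hgT : ContDiffOn ℝ n (fun y : ℝ => g y) T := fun y hy =>
    ((((hg y hy).contDiffAt (n := n)).restrict_scalars ℝ).comp y
      Complex.ofRealCLM.contDiff.contDiffAt).contDiffWithinAt
  have hC (i : ℕ) (hi : i ≤ n) :
      ‖iteratedFDerivWithin ℝ i (fun y : ℝ => g y) T (f ξ)‖ ≤
        n.factorial * M * (2 / δ) ^ n := by
    rw [iteratedFDerivWithin_of_isOpen i hT hξ, norm_iteratedFDeriv_eq_norm_iteratedDeriv,
      iteratedDeriv_comp_ofReal isOpen_ball hg i hξ]
    refine (norm_iteratedDeriv_le_of_ball hδ hg hM i).trans ?_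
    have : 1 ≤ 2 / δ := (one_le_div hδ).2 hδ₂
    gcongr
  have := norm_iteratedFDerivWithin_comp_le (s := f ⁻¹' T) hgT hf.contDiffOn le_rfl
    hT.uniqueDiffOn hS.uniqueDiffOn (mapsTo_preimage f T) hξ hC fun i _ hi => by
      rw [iteratedFDerivWithin_of_isOpen i hS hξ]
      exact hD i hi
  rwa [iteratedFDerivWithin_of_isOpen n hS hξ] at this

variable [InnerProductSpace ℝ V] {ξ : V} {ρ : ℝ}

lemma norm_iteratedFDeriv_id_le (hρ : 0 < ρ) (hξ : ‖ξ‖ ≤ ρ) (n : ℕ) :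
    ‖iteratedFDeriv ℝ n (fun η : V => η) ξ‖ ≤ ρ * (1 / ρ) ^ n := by
  have hderiv : fderiv ℝ (fun η : V => η) = fun _ => ContinuousLinearMap.id ℝ V :=
    funext fun _ => fderiv_fun_id
  match n with
  | 0 => simpa using hξ
  | 1 =>
    rw [← norm_iteratedFDeriv_fderiv, hderiv, norm_iteratedFDeriv_zero, pow_one,
      mul_one_div_cancel hρ.ne']
    exact ContinuousLinearMap.norm_id_le
  | n + 2 =>
    rw [← norm_iteratedFDeriv_fderiv, hderiv, iteratedFDeriv_const_of_ne n.succ_ne_zero]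
    simp only [Pi.zero_apply, norm_zero]
    positivity

lemma norm_iteratedFDeriv_normSq_div_le (hρ : 0 < ρ) (hξ : ‖ξ‖ ≤ ρ) (n : ℕ) :
    ‖iteratedFDeriv ℝ n (fun η : V => ‖η‖ ^ 2 / ρ ^ 2) ξ‖ ≤ (2 / ρ) ^ n := by
  have hinner : (fun η : V => ‖η‖ ^ 2 / ρ ^ 2) = fun η => (ρ ^ 2)⁻¹ • innerSL ℝ η η := by
    funext η
    rw [innerSL_apply_apply, real_inner_self_eq_norm_sq, smul_eq_mul, div_eq_inv_mul]
  have hsmooth : ContDiff ℝ n fun η : V => innerSL ℝ η η :=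
    (innerSL ℝ).contDiff.clm_apply contDiff_id
  have hterm (i : ℕ) (hi : i ∈ Finset.range (n + 1)) :
      (n.choose i : ℝ) * ‖iteratedFDeriv ℝ i (fun η : V => η) ξ‖ *
        ‖iteratedFDeriv ℝ (n - i) (fun η : V => η) ξ‖ ≤
      n.choose i * (ρ ^ 2 * (1 / ρ) ^ n) := by
    have hin : i + (n - i) = n := Nat.add_sub_cancel' (Finset.mem_range_succ_iff.1 hi)
    calc _ ≤ (n.choose i : ℝ) * (ρ * (1 / ρ) ^ i) * (ρ * (1 / ρ) ^ (n - i)) := by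
          gcongr <;> exact norm_iteratedFDeriv_id_le hρ hξ _
      _ = n.choose i * (ρ ^ 2 * (1 / ρ) ^ (i + (n - i))) := by ring
      _ = _ := by rw [hin]
  have hleibniz : ‖iteratedFDeriv ℝ n (fun η : V => innerSL ℝ η η) ξ‖ ≤
      2 ^ n * (ρ ^ 2 * (1 / ρ) ^ n) := by
    refine ((innerSL ℝ (E := V)).norm_iteratedFDeriv_le_of_bilinear_of_le_one contDiff_id
      contDiff_id ξ le_rfl (norm_innerSL_le ℝ)).trans ((Finset.sum_le_sum hterm).trans_eq ?_)
    have hchoose : ∑ i ∈ Finset.range (n + 1), (n.choose i : ℝ) = 2 ^ n := by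
      exact_mod_cast Nat.sum_range_choose n
    rw [← Finset.sum_mul, hchoose]
  rw [hinner, iteratedFDeriv_const_smul_apply' hsmooth.contDiffAt, norm_smul, norm_inv,
    Real.norm_of_nonneg (by positivity)]
  calc _ ≤ (ρ ^ 2)⁻¹ * (2 ^ n * (ρ ^ 2 * (1 / ρ) ^ n)) := by gcongr
    _ = (2 / ρ) ^ n := by rw [div_pow, div_pow, one_pow]; field_simp

lemma norm_iteratedFDeriv_comp_normSq_le {g : ℂ → ℂ} {δ M : ℝ} (hρ : 0 < ρ) (hξ : ‖ξ‖ ≤ ρ)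
    (hδ : 0 < δ) (hδ₂ : δ ≤ 2) (hg : AnalyticOnNhd ℂ g (ball (‖ξ‖ ^ 2 : ℝ) (δ * ρ ^ 2)))
    (hM : ∀ w ∈ ball ((‖ξ‖ ^ 2 : ℝ) : ℂ) (δ * ρ ^ 2), ‖g w‖ ≤ M) (n : ℕ) :
    ‖iteratedFDeriv ℝ n (fun η : V => g (‖η‖ ^ 2 : ℝ)) ξ‖ ≤
      n.factorial * (n.factorial * M * (2 / δ) ^ n) * (2 / ρ) ^ n := by
  have hρ₂ : ((ρ ^ 2 : ℝ) : ℂ) ≠ 0 := by exact_mod_cast (pow_pos hρ 2).ne'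
  have hcancel (η : V) : ((ρ ^ 2 : ℝ) : ℂ) * (‖η‖ ^ 2 / ρ ^ 2 : ℝ) = (‖η‖ ^ 2 : ℝ) := by
    rw [Complex.ofReal_div, mul_div_cancel₀ _ hρ₂]
  have hmap : MapsTo (fun u : ℂ => ((ρ ^ 2 : ℝ) : ℂ) * u) (ball (‖ξ‖ ^ 2 / ρ ^ 2 : ℝ) δ)
      (ball (‖ξ‖ ^ 2 : ℝ) (δ * ρ ^ 2)) := fun u hu => by
    rw [mem_ball, dist_eq_norm] at hu ⊢
    rw [← hcancel ξ, ← mul_sub, norm_mul, Complex.norm_of_nonneg (by positivity), mul_comm δ]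
    gcongr
  have := norm_iteratedFDeriv_comp_ofReal_le (f := fun η : V => ‖η‖ ^ 2 / ρ ^ 2) (D := 2 / ρ)
    hδ hδ₂ (hg.comp (analyticOnNhd_const.mul analyticOnNhd_id) hmap) (fun u hu => hM _ (hmap hu))
    ((contDiff_norm_sq ℝ).div_const _) (n := n)
    fun i _ => norm_iteratedFDeriv_normSq_div_le hρ hξ i
  simpa only [Function.comp_apply, Pi.mul_apply, id, hcancel] using this

end RealComposition

lemma analyticOnNhd_iteratedDeriv_left {G : ℂ × ℂ → ℂ} {U : Set (ℂ × ℂ)} (hU : IsOpen U)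
    (hG : AnalyticOnNhd ℂ G U) (n : ℕ) :
    AnalyticOnNhd ℂ (fun p => iteratedDeriv n (fun x => G (x, p.2)) p.1) U := by
  induction n with
  | zero => simpa using hG
  | succ n ih =>
    refine (((ContinuousLinearMap.apply ℂ ℂ ((1, 0) : ℂ × ℂ)).comp_analyticOnNhd ih.fderiv).congr
      hU fun p hp => ?_)
    have hpath : HasDerivAt (fun x : ℂ => (x, p.2)) (1, 0) p.1 :=
      (hasDerivAt_id p.1).prodMk (hasDerivAt_const p.1 p.2)
    simp only [iteratedDeriv_succ, Function.comp_apply, ContinuousLinearMap.apply_apply]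
    exact ((ih p hp).differentiableAt.hasFDerivAt.comp_hasDerivAt p.1 hpath).deriv.symm

lemma deriv_comp_exp {E : Type*} [NormedAddCommGroup E] [NormedSpace ℝ E] (f : ℝ → E) (x : ℝ) :
    deriv (fun y => f (Real.exp y)) x = Real.exp x • deriv f (Real.exp x) := by
  by_cases hf : DifferentiableAt ℝ f (Real.exp x)
  · exact (hf.hasDerivAt.scomp x (Real.hasDerivAt_exp x)).deriv
  · have hcomp : ¬ DifferentiableAt ℝ (fun y => f (Real.exp y)) x := fun h => by
      have hlog : DifferentiableAt ℝ (fun t => f (Real.exp (Real.log t))) (Real.exp x) :=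
        DifferentiableAt.comp (f := Real.log) (g := fun y => f (Real.exp y)) _
          (by rwa [Real.log_exp]) (Real.differentiableAt_log (Real.exp_ne_zero x))
      refine hf (hlog.congr_of_eventuallyEq ?_)
      filter_upwards [lt_mem_nhds (Real.exp_pos x)] with t ht using by rw [Real.exp_log ht]
    rw [deriv_zero_of_not_differentiableAt hf, deriv_zero_of_not_differentiableAt hcomp, smul_zero]

/-- The curve `Re λ + i eˣ Im λ`, for complex `x`. Along real `x`, the operator `τ ∂_τ` is
`d / dx`. -/
def imExp (lam x : ℂ) : ℂ := lam.re + lam.im * Complex.exp x * Complex.I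

lemma imExp_zero (lam : ℂ) : imExp lam 0 = lam := by
  rw [imExp, Complex.exp_zero, mul_one, Complex.re_add_im]

lemma tauDeriv_imExp (F : ℂ → ℂ) (lam : ℂ) (x : ℝ) :
    tauDeriv F (imExp lam x) = deriv (fun y : ℝ => F (imExp lam y)) x := by
  have hre : (imExp lam x).re = lam.re := by simp [imExp, ← Complex.ofReal_exp]
  have him : (imExp lam x).im = lam.im * Real.exp x := by simp [imExp, ← Complex.ofReal_exp]
  set φ : ℝ → ℂ := fun τ => F (lam.re + τ * Complex.I) with hφ
  have hcurve : (fun y : ℝ => F (imExp lam y)) = fun y => φ (lam.im * Real.exp y) := by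
    simp only [hφ, imExp, Complex.ofReal_mul, Complex.ofReal_exp]
  rw [tauDeriv, hre, him, hcurve, deriv_comp_exp fun t => φ (lam.im * t), deriv_comp_mul_left,
    smul_smul, mul_comm (Real.exp x), Complex.real_smul]

lemma iterate_tauDeriv_eq_iteratedDeriv (F : ℂ → ℂ) (lam : ℂ) (ℓ : ℕ) :
    tauDeriv^[ℓ] F lam = iteratedDeriv ℓ (fun y : ℝ => F (imExp lam y)) 0 := by
  suffices h : ∀ x : ℝ, tauDeriv^[ℓ] F (imExp lam x) =
      iteratedDeriv ℓ (fun y : ℝ => F (imExp lam y)) x by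
    simpa [imExp_zero] using h 0
  induction ℓ generalizing F with
  | zero => simp
  | succ ℓ ih =>
    intro x
    rw [Function.iterate_succ_apply, ih, iteratedDeriv_succ']
    simp only [tauDeriv_imExp]

lemma norm_imExp_sub_le (lam : ℂ) {x : ℂ} (hx : ‖x‖ ≤ 1) :
    ‖imExp lam x - lam‖ ≤ 2 * ‖x‖ * ‖lam‖ := by
  have heq : imExp lam x - lam = lam.im * (Complex.exp x - 1) * Complex.I := by
    rw [imExp]
    linear_combination Complex.re_add_im lam
  rw [heq, norm_mul, norm_mul, Complex.norm_I, mul_one, Complex.norm_real, mul_comm]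
  gcongr
  · exact Complex.norm_exp_sub_one_le hx
  · exact Complex.abs_im_le_norm lam

lemma analyticAt_imExp (lam x : ℂ) : AnalyticAt ℂ (imExp lam) x := by
  unfold imExp
  fun_prop

section SymbolEstimate

/-- The polydisc around `(λ, r²)` whose radii are `δ` times the parabolic scales of the two
variables. -/
def symbolPolydisc (δ : ℝ) (lam : ℂ) (r : ℝ) : Set (ℂ × ℂ) :=
  ball lam (δ * ‖lam‖) ×ˢ ball ((r ^ 2 : ℝ) : ℂ) (δ * (√‖lam‖ + r) ^ 2)

variable {V : Type*} [NormedAddCommGroup V] [InnerProductSpace ℝ V] {F : ℂ × ℂ → ℂ}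
  {f : ℂ → V → ℂ} {δ M : ℝ} {lam : ℂ} {ξ : V}

lemma isOpen_symbolPolydisc {r : ℝ} : IsOpen (symbolPolydisc δ lam r) :=
  isOpen_ball.prod isOpen_ball

lemma mem_symbolPolydisc_self {r : ℝ} (hδ : 0 < δ) (hlam : lam ≠ 0) (hr : 0 ≤ r) :
    (lam, ((r ^ 2 : ℝ) : ℂ)) ∈ symbolPolydisc δ lam r := by
  have : 0 < ‖lam‖ := norm_pos_iff.2 hlam
  exact ⟨mem_ball_self (by positivity), mem_ball_self (by positivity)⟩

lemma mapsTo_imExp (hδ₁ : δ ≤ 1) (hlam : lam ≠ 0) :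
    MapsTo (imExp lam) (ball 0 (δ / 2)) (ball lam (δ * ‖lam‖)) := fun x hx => by
  have hx' : ‖x‖ < δ / 2 := mem_ball_zero_iff.1 hx
  have : 0 < ‖lam‖ := norm_pos_iff.2 hlam
  rw [mem_ball, dist_eq_norm]
  refine (norm_imExp_sub_le lam (by linarith)).trans_lt ?_
  gcongr
  linarith

lemma contDiffAt_of_eqOn_symbolPolydisc (hδ : 0 < δ) (hlam : lam ≠ 0)
    (hF : AnalyticOnNhd ℂ F (symbolPolydisc δ lam ‖ξ‖))
    (hf : ∀ z η, (z, ((‖η‖ ^ 2 : ℝ) : ℂ)) ∈ symbolPolydisc δ lam ‖ξ‖ →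
      f z η = F (z, (‖η‖ ^ 2 : ℝ))) :
    ContDiffAt ℝ ∞ (fun p : ℂ × V => f p.1 p.2) (lam, ξ) := by
  have hmem := mem_symbolPolydisc_self hδ hlam (norm_nonneg ξ)
  have hlift : ContDiff ℝ ∞ fun p : ℂ × V => (p.1, ((‖p.2‖ ^ 2 : ℝ) : ℂ)) :=
    contDiff_fst.prodMk (Complex.ofRealCLM.contDiff.comp (contDiff_snd.norm_sq ℝ))
  refine ContDiffAt.congr_of_eventuallyEq
    ((((hF _ hmem).contDiffAt (n := ∞)).restrict_scalars ℝ).comp (lam, ξ) hlift.contDiffAt) ?_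
  filter_upwards [hlift.continuous.continuousAt.eventually_mem
    (isOpen_symbolPolydisc.mem_nhds hmem)] with p hp using hf _ _ hp

theorem norm_iteratedFDeriv_iterate_tauDeriv_le (hδ : 0 < δ) (hδ₁ : δ ≤ 1) (hlam : lam ≠ 0)
    (hF : AnalyticOnNhd ℂ F (symbolPolydisc δ lam ‖ξ‖))
    (hM : ∀ p ∈ symbolPolydisc δ lam ‖ξ‖, ‖F p‖ ≤ M)
    (hf : ∀ z η, (z, ((‖η‖ ^ 2 : ℝ) : ℂ)) ∈ symbolPolydisc δ lam ‖ξ‖ →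
      f z η = F (z, (‖η‖ ^ 2 : ℝ))) (n ℓ : ℕ) :
    ‖iteratedFDeriv ℝ n (fun η => tauDeriv^[ℓ] (fun z => f z η) lam) ξ‖ ≤
      n.factorial * (n.factorial * (ℓ.factorial * M * (4 / δ) ^ ℓ) * (2 / δ) ^ n) *
        (2 / (√‖lam‖ + ‖ξ‖)) ^ n := by
  have hρ : 0 < √‖lam‖ + ‖ξ‖ := add_pos_of_pos_of_nonneg (by positivity) (norm_nonneg ξ)
  set D : Set ℂ := ball ((‖ξ‖ ^ 2 : ℝ) : ℂ) (δ * (√‖lam‖ + ‖ξ‖) ^ 2)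
  set G : ℂ × ℂ → ℂ := fun p => F (imExp lam p.1, p.2)
  have hmaps := mapsTo_imExp hδ₁ hlam
  have hG : AnalyticOnNhd ℂ G (ball 0 (δ / 2) ×ˢ D) := fun p hp =>
    (hF (imExp lam p.1, p.2) ⟨hmaps hp.1, hp.2⟩).comp₂
      ((analyticAt_imExp lam p.1).comp analyticAt_fst) analyticAt_snd
  have hG' {w : ℂ} (hw : w ∈ D) : AnalyticOnNhd ℂ (fun x => G (x, w)) (ball 0 (δ / 2)) :=
    fun x hx => (hG (x, w) ⟨hx, hw⟩).comp₂ analyticAt_id analyticAt_const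
  have h0 : (0 : ℂ) ∈ ball (0 : ℂ) (δ / 2) := mem_ball_self (half_pos hδ)
  set g : ℂ → ℂ := fun w => iteratedDeriv ℓ (fun x => G (x, w)) 0
  have hg : AnalyticOnNhd ℂ g D := fun w hw =>
    (analyticOnNhd_iteratedDeriv_left (isOpen_ball.prod isOpen_ball) hG ℓ (0, w) ⟨h0, hw⟩).comp₂
      analyticAt_const analyticAt_id
  have hgM (w : ℂ) (hw : w ∈ D) : ‖g w‖ ≤ ℓ.factorial * M * (4 / δ) ^ ℓ := by
    convert norm_iteratedDeriv_le_of_ball (half_pos hδ) (hG' hw)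
      (fun x hx => hM _ ⟨hmaps hx, hw⟩) ℓ using 3
    field_simp
    norm_num
  have hfg : (fun η => tauDeriv^[ℓ] (fun z => f z η) lam) =ᶠ[𝓝 ξ] fun η => g (‖η‖ ^ 2 : ℝ) := by
    have hcont : Continuous fun η : V => ((‖η‖ ^ 2 : ℝ) : ℂ) := by fun_prop
    filter_upwards [hcont.continuousAt.eventually_mem
      (isOpen_ball.mem_nhds (mem_ball_self (by positivity : 0 < δ * (√‖lam‖ + ‖ξ‖) ^ 2)))]
      with η hη
    have hline : (fun y : ℝ => f (imExp lam y) η) =ᶠ[𝓝 0] fun y : ℝ => G (y, (‖η‖ ^ 2 : ℝ)) := by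
      filter_upwards [Complex.continuous_ofReal.continuousAt.eventually_mem
        (isOpen_ball.mem_nhds (by rwa [Complex.ofReal_zero]))] with y hy using hf _ _ ⟨hmaps hy, hη⟩
    rw [iterate_tauDeriv_eq_iteratedDeriv, hline.iteratedDeriv_eq,
      iteratedDeriv_comp_ofReal isOpen_ball (hG' hη) ℓ (by rwa [Complex.ofReal_zero]),
      Complex.ofReal_zero]
  rw [(hfg.iteratedFDeriv ℝ n).eq_of_nhds]
  exact norm_iteratedFDeriv_comp_normSq_le hρ (le_add_of_nonneg_left (Real.sqrt_nonneg _)) hδ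
    (by linarith) hg hgM n

end SymbolEstimate

/-! ### The Lopatinski symbol -/

section Lopatinski

variable {α κ z w : ℂ}

lemma Regular.rootSymb_mul_sub_ne_zero (h : Regular α κ z w) (hz : z ≠ 0) :
    rootSymb (α + κ) z w * rootSymb α z w - w ≠ 0 := fun h₀ => by
  have hid := rootSymb_mul_sub_mul_add (z := z) (w := w) h.add_ne_zero h.left_ne_zero
  rw [h₀, zero_mul, mul_zero] at hid
  exact mul_ne_zero hz h.den_ne_zero hid.symm

lemma Regular.lopFactor_eq_div (h : Regular α κ z w) (hz : z ≠ 0) :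
    lopFactor α κ z w = z / (rootSymb (α + κ) z w * rootSymb α z w - w) := by
  rw [lopFactor, div_eq_div_iff h.den_ne_zero (h.rootSymb_mul_sub_ne_zero hz)]
  linear_combination rootSymb_mul_sub_mul_add (z := z) (w := w) h.add_ne_zero h.left_ne_zero

end Lopatinski

section Identification

variable {d : ℕ} {α β : ℝ} {κ ζ z : ℂ} {ξ : EuclideanSpace ℝ (Fin d)}

lemma symbA_eq_rootSymb (hκ : κ = α + β + ζ) : symbA α β ζ z ξ = rootSymb (α + κ) z (xiSq ξ) := by
  rw [symbA, rootSymb, show 2 * (α : ℂ) + β + ζ = α + κ by rw [hκ]; ring]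

lemma lopatinski_zero_zero (hκ : κ = α + β + ζ) (hz : z ≠ 0) (h : Regular α κ z (xiSq ξ)) :
    lopatinski α β ζ z ξ 0 0 = lopFactor α κ z (xiSq ξ) * rootSymb (α + κ) z (xiSq ξ) := by
  have hB := mul_rootSymb_sq_sub h.left_ne_zero z (xiSq ξ)
  rw [h.lopFactor_eq_div hz, div_mul_eq_mul_div, ← symbA_eq_rootSymb hκ]
  change α * symbA α β ζ z ξ * (rootSymb α z (xiSq ξ) ^ 2 - xiSq ξ) / _ = _
  congr 1
  linear_combination symbA α β ζ z ξ * hB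

lemma det_lopatinski (hκ : κ = α + β + ζ) (hz : z ≠ 0) (h : Regular α κ z (xiSq ξ)) :
    (lopatinski α β ζ z ξ).det = lopFactor α κ z (xiSq ξ) * rayleighQuot α κ z (xiSq ξ) := by
  have hA₂ := mul_rootSymb_sq_sub h.add_ne_zero z (xiSq ξ)
  have hB₂ := mul_rootSymb_sq_sub h.left_ne_zero z (xiSq ξ)
  have hE := h.rootSymb_mul_sub_ne_zero hz
  have hray := h.mul_rayleighQuot
  rw [h.lopFactor_eq_div hz, lopatinski, Matrix.det_fin_two_of, symbA_eq_rootSymb hκ,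
    show symbB α z ξ = rootSymb α z (xiSq ξ) from rfl]
  generalize rootSymb (α + κ) z (xiSq ξ) = A at *
  generalize rootSymb α z (xiSq ξ) = B at *
  generalize xiSq ξ = s at *
  have h₁₁ : α * A * (B ^ 2 - s) = A * z := by linear_combination A * hB₂
  have h₂₂ : (2 * α + β + ζ) * B * (A ^ 2 - s) = B * z := by
    rw [show 2 * (α : ℂ) + β + ζ = α + κ by rw [hκ]; ring]
    linear_combination B * hA₂
  have h₂₁ : 2 * α * A * (B - A) - (β + ζ) * (A ^ 2 - s) = α * (2 * A * B - s - B ^ 2) := by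
    rw [show (β : ℂ) + ζ = κ - α by rw [hκ]; ring]
    linear_combination hB₂ - hA₂
  have hz₂ : z ^ 2 = α ^ 2 * (B ^ 2 - s) ^ 2 := by rw [← hB₂]; ring
  rw [h₁₁, h₂₂, h₂₁, div_mul_div_comm, div_mul_div_comm, ← sub_div, div_mul_eq_mul_div, hray,
    div_eq_div_iff (mul_ne_zero hE hE) hE]
  linear_combination (A * B) * (A * B - s) * hz₂

lemma symbN_eq_symbHol (hκ : κ = α + β + ζ) (hz : z ≠ 0) (h : Regular α κ z (xiSq ξ)) (σ m : ℝ) :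
    symbN α β ζ z ξ σ m = symbHol σ m α κ z (xiSq ξ) := by
  rw [symbN, det_lopatinski hκ hz h, lopatinski_zero_zero hκ hz h, symbHol, weightedSymb]
  ring

/-- The value of `κ = α + β + ζ` at `z`. -/
def kappaOf (ν γ₁ γ₃ : ℝ) (Z : ZetaParam) (z : ℂ) : ℂ := ((γ₁⁻¹ * ν : ℝ) : ℂ) + Z.val γ₁ γ₃ z

lemma analyticAt_kappaOf (ν γ₁ γ₃ : ℝ) (Z : ZetaParam) (hz : z ≠ 0) :
    AnalyticAt ℂ (kappaOf ν γ₁ γ₃ Z) z := by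
  refine analyticAt_const.add ?_
  cases Z with
  | recip => exact analyticAt_const.mul (analyticAt_id.inv hz)
  | const ζ => exact analyticAt_const

/-- `N(A, B)` as a holomorphic function of `λ` and `|ξ'|²`. -/
def reducedSymb (σ m μ ν γ₁ γ₃ : ℝ) (Z : ZetaParam) (p : ℂ × ℂ) : ℂ :=
  symbHol σ m (γ₁⁻¹ * μ : ℝ) (kappaOf ν γ₁ γ₃ Z p.1) p.1 p.2

/-- On `U` the reduced symbol is regular and bounded below by `b`. -/
def SymbolLowerBound (σ m μ ν γ₁ γ₃ : ℝ) (Z : ZetaParam) (U : Set (ℂ × ℂ)) (b : ℝ) : Prop :=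
  ∀ p ∈ U, p.1 ≠ 0 ∧ Regular (γ₁⁻¹ * μ : ℝ) (kappaOf ν γ₁ γ₃ Z p.1) p.1 p.2 ∧
    b ≤ ‖reducedSymb σ m μ ν γ₁ γ₃ Z p‖

namespace SymbolLowerBound

variable {σ m μ ν γ₁ γ₃ b : ℝ} {Z : ZetaParam} {U : Set (ℂ × ℂ)}

lemma analyticOnNhd_inv (H : SymbolLowerBound σ m μ ν γ₁ γ₃ Z U b) (hb : 0 < b) :
    AnalyticOnNhd ℂ (fun p => (reducedSymb σ m μ ν γ₁ γ₃ Z p)⁻¹) U := fun p hp => by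
  obtain ⟨hz, hreg, hle⟩ := H p hp
  refine AnalyticAt.inv ?_ (norm_pos_iff.1 (hb.trans_le hle))
  exact Regular.analyticAt_weightedSymb analyticAt_const
    ((analyticAt_kappaOf ν γ₁ γ₃ Z hz).comp analyticAt_fst) analyticAt_fst analyticAt_snd hreg
    σ analyticAt_fst analyticAt_const analyticAt_const

lemma norm_inv_le (H : SymbolLowerBound σ m μ ν γ₁ γ₃ Z U b) (hb : 0 < b) {p : ℂ × ℂ}
    (hp : p ∈ U) : ‖(reducedSymb σ m μ ν γ₁ γ₃ Z p)⁻¹‖ ≤ b⁻¹ := by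
  rw [norm_inv]
  exact inv_anti₀ hb (H p hp).2.2

lemma symbNAB_eq (H : SymbolLowerBound σ m μ ν γ₁ γ₃ Z U b) {η : EuclideanSpace ℝ (Fin d)}
    (hp : (z, ((‖η‖ ^ 2 : ℝ) : ℂ)) ∈ U) :
    symbNAB σ m μ ν γ₁ γ₃ Z z η = reducedSymb σ m μ ν γ₁ γ₃ Z (z, (‖η‖ ^ 2 : ℝ)) := by
  obtain ⟨hz, hreg, -⟩ := H _ hp
  exact symbN_eq_symbHol (by rw [kappaOf]; push_cast; ring) hz hreg σ m

end SymbolLowerBound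

end Identification

/-! ### Admissible directions -/

lemma neg_cos_mul_norm_le_re {ε : ℝ} (hε : 0 < ε) {z : ℂ} (hz : z ∈ sectorSet ε) :
    -Real.cos ε * ‖z‖ ≤ z.re := by
  have hcos : Real.cos (Real.pi - ε) ≤ Real.cos |z.arg| :=
    Real.cos_le_cos_of_nonneg_of_le_pi (abs_nonneg _) (by linarith) hz.2
  rw [Real.cos_pi_sub, Real.cos_abs] at hcos
  rw [← Complex.norm_mul_cos_arg z, mul_comm]
  gcongr

lemma im_ne_zero_of_mem_sectorSet {ε : ℝ} (hε : 0 < ε) {z : ℂ} (hz : z ∈ sectorSet ε)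
    (hre : z.re < 0) : z.im ≠ 0 := fun him => by
  have harg := hz.2
  rw [Complex.arg_eq_pi_iff.2 ⟨hre, him⟩, abs_of_pos Real.pi_pos] at harg
  linarith

/-- The limit of the parameter `ζ` as `|λ| → ∞`. -/
def ZetaParam.limit : ZetaParam → ℂ
  | recip => 0
  | const ζ => ζ

lemma HalfPlane.of_re_nonneg {p : ℝ} {ζ θ : ℂ} (hp : 0 < p) (hζ : 0 ≤ ζ.re) (hθ : 0 ≤ θ.re) :
    HalfPlane (p + ζ) θ := by
  refine ⟨1, by simp, by simpa using hθ, ?_⟩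
  simp only [one_mul, Complex.add_re, Complex.ofReal_re]
  positivity

/-- The pairs `(ζ, λ)` in the three cases: `ζ = 0` and `λ` in the sector `Re λ ≥ -c |λ|`, or
`Re λ ≥ 0` and either `Re ζ ≥ 0`, or `ζ` lies in that sector and `λ` satisfies the restriction of
(C2) (with the denominator `Im ζ` cleared). The conditions are homogeneous in `λ` and closed. -/
def AdmissibleDir (c : ℝ) (ζ lam : ℂ) : Prop :=
  (ζ = 0 ∧ -c * ‖lam‖ ≤ lam.re) ∨
    (0 ≤ lam.re ∧ (0 ≤ ζ.re ∨ (-c * ‖ζ‖ ≤ ζ.re ∧ |ζ.re| * |lam.im| ≤ |ζ.im| * lam.re)))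

namespace AdmissibleDir

variable {c : ℝ} {ζ lam θ : ℂ}

lemma conj_left (h : AdmissibleDir c ζ lam) : AdmissibleDir c (conj ζ) lam := by
  simpa [AdmissibleDir] using h

lemma ofReal_mul {t : ℝ} (ht : 0 ≤ t) (h : AdmissibleDir c ζ lam) :
    AdmissibleDir c ζ (t * lam) := by
  simp only [AdmissibleDir, norm_mul, Complex.norm_of_nonneg ht, Complex.re_ofReal_mul,
    Complex.im_ofReal_mul, abs_mul, abs_of_nonneg ht]
  refine h.imp (And.imp_right fun hre => ?_) (And.imp (mul_nonneg ht) (Or.imp_right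
    (And.imp_right fun him => ?_)))
  · linarith [mul_le_mul_of_nonneg_left hre ht]
  · linarith [mul_le_mul_of_nonneg_left him ht]

lemma halfPlane (hc : c < 1) {p : ℝ} (hp : 0 < p) (hθ : ‖θ‖ = 1) (h : AdmissibleDir c ζ θ) :
    HalfPlane (p + ζ) θ := by
  rcases h with ⟨rfl, hre⟩ | ⟨hre, hζ | ⟨hζ, hcross⟩⟩
  · rw [hθ, mul_one] at hre
    have hχ : 0 < (1 + conj θ).re := by
      simp only [Complex.add_re, Complex.one_re, Complex.conj_re]
      linarith
    refine ⟨1 + conj θ, hχ, ?_, ?_⟩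
    · rw [add_mul, Complex.conj_mul', hθ]
      simp only [Complex.add_re, one_mul, Complex.ofReal_one, one_pow, Complex.one_re]
      linarith
    · rw [add_zero, Complex.re_mul_ofReal]
      positivity
  · exact .of_re_nonneg hp hζ hre
  · rcases le_or_gt 0 ζ.re with hζ₀ | hζ₀
    · exact .of_re_nonneg hp hζ₀ hre
    have him : ζ.im ≠ 0 := fun him => by
      rw [← Complex.abs_re_eq_norm.2 him, abs_of_neg hζ₀] at hζ
      nlinarith
    -- With `χ = Im ζ (Im ζ + i Re ζ)` the product `χ ζ` is purely imaginary.
    refine ⟨⟨ζ.im ^ 2, ζ.im * ζ.re⟩, by positivity, ?_, ?_⟩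
    · rw [Complex.mul_re]
      have hsign : ζ.im * ζ.re * θ.im ≤ |ζ.im| * (|ζ.re| * |θ.im|) := by
        rw [← abs_mul, ← abs_mul, ← mul_assoc]
        exact le_abs_self _
      have hle := mul_le_mul_of_nonneg_left hcross (abs_nonneg ζ.im)
      rw [← mul_assoc |ζ.im| |ζ.im|, abs_mul_abs_self] at hle
      linarith
    · have : (⟨ζ.im ^ 2, ζ.im * ζ.re⟩ * (p + ζ) : ℂ).re = ζ.im ^ 2 * p := by
        simp only [Complex.mul_re, Complex.add_re, Complex.ofReal_re, Complex.add_im,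
          Complex.ofReal_im]
        ring
      rw [this]
      positivity

lemma isElliptic (hc : c < 1) {α p : ℝ} (hα : 0 < α) (hp : 0 < p) (hθ : ‖θ‖ = 1)
    (h : AdmissibleDir c ζ θ) : IsElliptic α (p + ζ) θ where
  pos := hα
  norm_eq_one := hθ
  halfPlane := h.halfPlane hc hp hθ
  halfPlane_conj := by
    rw [map_add, Complex.conj_ofReal]
    exact h.conj_left.halfPlane hc hp hθ

end AdmissibleDir

lemma isClosed_setOf_admissibleDir (c : ℝ) :
    IsClosed {p : ℂ × ℂ | AdmissibleDir c p.1 p.2} := by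
  simp only [AdmissibleDir, ofPred_or, ofPred_and]
  exact ((isClosed_eq (by fun_prop) (by fun_prop)).inter
    (isClosed_le (by fun_prop) (by fun_prop))).union
      ((isClosed_le (by fun_prop) (by fun_prop)).inter
        ((isClosed_le (by fun_prop) (by fun_prop)).union
          ((isClosed_le (by fun_prop) (by fun_prop)).inter
            (isClosed_le (by fun_prop) (by fun_prop)))))

lemma ZetaParam.Admissible.of_mem_region {ε ζ₀ ν ρ₃ lam₀ : ℝ} (hε : 0 < ε) (hlam₀ : 0 ≤ lam₀)
    {Z : ZetaParam} (hZ : Z.Admissible ε ζ₀) {lam : ℂ} (hlam : lam ∈ Z.region ν ρ₃ ε lam₀) :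
    lam₀ ≤ ‖lam‖ ∧ ‖Z.limit‖ ≤ max ζ₀ 0 ∧ AdmissibleDir (Real.cos ε) Z.limit lam := by
  cases Z with
  | recip =>
    obtain ⟨⟨hsec, hle⟩, -⟩ := hlam
    exact ⟨hle, by simp [ZetaParam.limit], .inl ⟨rfl, neg_cos_mul_norm_le_re hε hsec⟩⟩
  | const ζ =>
    obtain ⟨hζ, hsec⟩ := hZ
    have hR : ‖ζ‖ ≤ max ζ₀ 0 := hζ.trans (le_max_left _ _)
    rcases lt_or_ge ζ.re 0 with hre | hre
    · simp only [ZetaParam.region, if_pos hre, mem_ofPred_eq] at hlam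
      obtain ⟨hcross, hle⟩ := hlam
      replace hsec : ζ ∈ sectorSet ε := (hsec.resolve_right hre.not_ge).1
      rw [abs_div, div_mul_eq_mul_div,
        div_le_iff₀' (abs_pos.2 (im_ne_zero_of_mem_sectorSet hε hsec hre))] at hcross
      exact ⟨hle.trans (Complex.re_le_norm lam), hR, .inr ⟨hlam₀.trans hle,
        .inr ⟨neg_cos_mul_norm_le_re hε hsec, hcross⟩⟩⟩
    · simp only [ZetaParam.region, if_neg hre.not_gt, mem_ofPred_eq] at hlam
      exact ⟨hlam.trans (Complex.re_le_norm lam), hR, .inr ⟨hlam₀.trans hlam, .inl hre⟩⟩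

/-- The limits of `(α, κ, λ / |λ|)` for large `|λ|`, over all admissible parameters. -/
def limitParams (c R μ ν ρ₁ ρ₂ : ℝ) : Set (ℝ × ℂ × ℂ) :=
  (fun p : ℝ × ℂ × ℂ => (p.1⁻¹ * μ, ((p.1⁻¹ * ν : ℝ) : ℂ) + p.2.1, p.2.2)) ''
    (Icc ρ₁ ρ₂ ×ˢ ((closedBall 0 R ×ˢ sphere 0 1) ∩ {p | AdmissibleDir c p.1 p.2}))

lemma isCompact_limitParams (c R μ ν : ℝ) {ρ₁ ρ₂ : ℝ} (hρ₁ : 0 < ρ₁) :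
    IsCompact (limitParams c R μ ν ρ₁ ρ₂) := by
  refine (isCompact_Icc.prod (((isCompact_closedBall _ _).prod (isCompact_sphere _ _)).inter_right
    (isClosed_setOf_admissibleDir c))).image_of_continuousOn ?_
  have hne : ∀ p ∈ Icc ρ₁ ρ₂ ×ˢ ((closedBall (0 : ℂ) R ×ˢ sphere (0 : ℂ) 1) ∩
      {p | AdmissibleDir c p.1 p.2}), p.1 ≠ 0 := fun p hp => (hρ₁.trans_le hp.1.1).ne'
  fun_prop (disch := assumption)

lemma isElliptic_of_mem_limitParams {c R μ ν ρ₁ ρ₂ : ℝ} (hc : c < 1) (hμ : 0 < μ) (hν : 0 < ν)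
    (hρ₁ : 0 < ρ₁) : ∀ q ∈ limitParams c R μ ν ρ₁ ρ₂, IsElliptic q.1 q.2.1 q.2.2 := by
  rintro _ ⟨⟨γ, ζ, θ⟩, ⟨hγ, ⟨-, hθ⟩, hdir⟩, rfl⟩
  have : 0 < γ := hρ₁.trans_le hγ.1
  exact hdir.isElliptic hc (by positivity) (by positivity) (mem_sphere_zero_iff_norm.1 hθ)

lemma norm_kappaOf_sub_le {ν γ₁ γ₃ ρ₁ ρ₃ δ : ℝ} (hρ₁ : 0 < ρ₁) (hδ : 0 < δ) (hγ₁ : ρ₁ ≤ γ₁)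
    (hγ₃ : |γ₃| ≤ ρ₃) (Z : ZetaParam) {lam z : ℂ} (hlam : lam ≠ 0)
    (hL : 2 * ρ₃ / (ρ₁ * δ) ≤ ‖lam‖) (hz : ‖z - lam‖ ≤ 1 / 2 * ‖lam‖) :
    ‖kappaOf ν γ₁ γ₃ Z z - (((γ₁⁻¹ * ν : ℝ) : ℂ) + Z.limit)‖ ≤ δ := by
  rw [kappaOf, add_sub_add_left_eq_sub]
  cases Z with
  | const ζ => simpa [ZetaParam.val, ZetaParam.limit] using hδ.le
  | recip =>
    have hlam' : 0 < ‖lam‖ := norm_pos_iff.2 hlam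
    have hhalf : ‖lam‖ / 2 ≤ ‖z‖ := by
      have := norm_sub_norm_le lam z
      rw [norm_sub_rev] at this
      linarith
    have hz₀ : 0 < ‖z‖ := by linarith
    have hγ : 0 < γ₁ := by linarith
    simp only [ZetaParam.val, ZetaParam.limit, sub_zero, norm_mul, norm_inv, Complex.norm_real,
      Real.norm_eq_abs, abs_of_pos hγ]
    rw [div_le_iff₀ (by positivity)] at hL
    rw [← div_eq_mul_inv, inv_mul_eq_div, div_div, div_le_iff₀ (by positivity)]
    calc |γ₃| ≤ δ * (ρ₁ * (‖lam‖ / 2)) := by linarith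
      _ ≤ δ * (γ₁ * ‖z‖) := by gcongr

/-! ### The symbol estimates -/

theorem exists_symbolLowerBound {c σ μ ν ρ₁ : ℝ} (m R ρ₂ ρ₃ : ℝ) (hc : c < 1) (hσ : 0 < σ)
    (hμ : 0 < μ) (hν : 0 < ν) (hρ₁ : 0 < ρ₁) :
    ∃ δ : ℝ, 0 < δ ∧ δ ≤ 1 ∧ ∃ b : ℝ, 0 < b ∧ ∃ lam₀ : ℝ, 1 ≤ lam₀ ∧
      ∀ (γ₁ γ₃ : ℝ) (Z : ZetaParam), ρ₁ ≤ γ₁ → γ₁ ≤ ρ₂ → |γ₃| ≤ ρ₃ → ‖Z.limit‖ ≤ R →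
      ∀ lam : ℂ, lam₀ ≤ ‖lam‖ → AdmissibleDir c Z.limit lam → ∀ r : ℝ,
        SymbolLowerBound σ m μ ν γ₁ γ₃ Z (symbolPolydisc δ lam r)
          (b * ((‖lam‖ + r) * (√‖lam‖ + r) ^ 2)) := by
  obtain ⟨δ, hδ, b, hb, lam₀, hlam₀, H⟩ := exists_symbHol_lower_bound
    (isCompact_limitParams c R μ ν (ρ₂ := ρ₂) hρ₁) (isElliptic_of_mem_limitParams hc hμ hν hρ₁)
    hσ m
  refine ⟨min δ (1 / 2), lt_min hδ one_half_pos, (min_le_right _ _).trans one_half_lt_one.le,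
    b, hb, max lam₀ (2 * ρ₃ / (ρ₁ * δ)), hlam₀.trans (le_max_left _ _), ?_⟩
  intro γ₁ γ₃ Z h₁ h₂ h₃ hR lam hL hdir r p ⟨hz, hw⟩
  have hlam : 0 < ‖lam‖ := by linarith [(le_max_left _ _).trans hL]
  replace hz : ‖p.1 - lam‖ < min δ (1 / 2) * ‖lam‖ := mem_ball_iff_norm.1 hz
  have hzhalf : ‖p.1 - lam‖ < 1 / 2 * ‖lam‖ := hz.trans_le (by gcongr; exact min_le_right _ _)
  have hp : p.1 ≠ 0 := by
    rintro h
    rw [h, zero_sub, norm_neg] at hzhalf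
    linarith
  have hunit : (lam / ‖lam‖ : ℂ) = (‖lam‖⁻¹ : ℝ) * lam := by
    rw [Complex.ofReal_inv, div_eq_inv_mul]
  have hmem : (γ₁⁻¹ * μ, ((γ₁⁻¹ * ν : ℝ) : ℂ) + Z.limit, (lam / ‖lam‖ : ℂ)) ∈
      limitParams c R μ ν ρ₁ ρ₂ := by
    refine ⟨(γ₁, Z.limit, lam / ‖lam‖), ⟨⟨h₁, h₂⟩, ⟨mem_closedBall_zero_iff.2 hR, ?_⟩, ?_⟩, rfl⟩
    · rw [mem_sphere_zero_iff_norm, norm_div, Complex.norm_real, norm_norm, div_self hlam.ne']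
    · rw [hunit]
      exact hdir.ofReal_mul (by positivity)
  refine ⟨hp, H _ _ _ hmem ‖lam‖ r ((le_max_left _ _).trans hL) _ _ _
    (norm_kappaOf_sub_le hρ₁ hδ h₁ h₃ Z (norm_pos_iff.1 hlam) ((le_max_right _ _).trans hL)
      hzhalf.le) ?_ ?_⟩
  · rw [mul_div_cancel₀ lam (by exact_mod_cast hlam.ne')]
    exact hz.le.trans (by gcongr; exact min_le_left _ _)
  · exact (mem_ball_iff_norm.1 hw).le.trans (by gcongr; exact min_le_left _ _)

lemma norm_multiDeriv_le_norm_iteratedFDeriv {d : ℕ} (κ : Fin d → ℕ)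
    (f : EuclideanSpace ℝ (Fin d) → ℂ) (ξ : EuclideanSpace ℝ (Fin d)) :
    ‖multiDeriv κ f ξ‖ ≤ ‖iteratedFDeriv ℝ (∑ j, κ j) f ξ‖ := by
  refine (ContinuousMultilinearMap.le_opNorm _ _).trans ?_
  simp

namespace SymbolLowerBound

variable {σ m μ ν γ₁ γ₃ δ b : ℝ} {Z : ZetaParam} {lam : ℂ} {d : ℕ} {ξ : EuclideanSpace ℝ (Fin d)}

lemma le_norm_symbNAB (H : SymbolLowerBound σ m μ ν γ₁ γ₃ Z (symbolPolydisc δ lam ‖ξ‖) b)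
    (hδ : 0 < δ) (hlam : lam ≠ 0) : b ≤ ‖symbNAB σ m μ ν γ₁ γ₃ Z lam ξ‖ := by
  have hmem := mem_symbolPolydisc_self hδ hlam (norm_nonneg ξ)
  rw [H.symbNAB_eq hmem]
  exact (H _ hmem).2.2

lemma contDiffAt_inv (H : SymbolLowerBound σ m μ ν γ₁ γ₃ Z (symbolPolydisc δ lam ‖ξ‖) b)
    (hδ : 0 < δ) (hlam : lam ≠ 0) (hb : 0 < b) :
    ContDiffAt ℝ ∞ (fun p : ℂ × EuclideanSpace ℝ (Fin d) =>
      (symbNAB σ m μ ν γ₁ γ₃ Z p.1 p.2)⁻¹) (lam, ξ) :=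
  contDiffAt_of_eqOn_symbolPolydisc (f := fun z η => (symbNAB σ m μ ν γ₁ γ₃ Z z η)⁻¹) hδ hlam
    (H.analyticOnNhd_inv hb) fun _ _ hp => congrArg _ (H.symbNAB_eq hp)

lemma norm_multiDeriv_le (H : SymbolLowerBound σ m μ ν γ₁ γ₃ Z (symbolPolydisc δ lam ‖ξ‖)
      (b * ((‖lam‖ + ‖ξ‖) * (√‖lam‖ + ‖ξ‖) ^ 2)))
    (hδ : 0 < δ) (hδ₁ : δ ≤ 1) (hlam : lam ≠ 0) (hb : 0 < b) (κ : Fin d → ℕ) {n : ℕ}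
    (hn : ∑ j, κ j = n) (ℓ : ℕ) :
    ‖multiDeriv κ (fun η => tauDeriv^[ℓ] (fun z => (symbNAB σ m μ ν γ₁ γ₃ Z z η)⁻¹) lam) ξ‖ ≤
      n.factorial * (n.factorial * (ℓ.factorial * b⁻¹ * (4 / δ) ^ ℓ) * (2 / δ) ^ n) * 2 ^ n *
        (‖lam‖ + ‖ξ‖)⁻¹ * ((√‖lam‖ + ‖ξ‖) ^ (2 + n))⁻¹ := by
  have : 0 < ‖lam‖ := norm_pos_iff.2 hlam
  have hpos : 0 < b * ((‖lam‖ + ‖ξ‖) * (√‖lam‖ + ‖ξ‖) ^ 2) := by positivity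
  refine (norm_multiDeriv_le_norm_iteratedFDeriv κ _ ξ).trans ?_
  rw [hn]
  refine (norm_iteratedFDeriv_iterate_tauDeriv_le hδ hδ₁ hlam (H.analyticOnNhd_inv hpos)
    (fun p hp => H.norm_inv_le hpos hp) (fun z η hp => congrArg _ (H.symbNAB_eq hp)) n
    ℓ).trans_eq ?_
  rw [mul_inv, mul_inv, div_pow 2 (√‖lam‖ + ‖ξ‖), pow_add, mul_inv]
  ring

end SymbolLowerBound

theorem lemma3p10_general {c σ μ ν ρ₁ : ℝ} (m R ρ₂ ρ₃ : ℝ) (hc : c < 1) (hσ : 0 < σ)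
    (hμ : 0 < μ) (hν : 0 < ν) (hρ₁ : 0 < ρ₁) :
    ∃ lam₀ : ℝ, 1 ≤ lam₀ ∧ ∃ b : ℝ, 0 < b ∧ ∀ d : ℕ,
      (∀ (γ₁ γ₃ : ℝ) (Z : ZetaParam), ρ₁ ≤ γ₁ → γ₁ ≤ ρ₂ → |γ₃| ≤ ρ₃ →
        ∀ lam : ℂ, lam₀ ≤ ‖lam‖ ∧ ‖Z.limit‖ ≤ R ∧ AdmissibleDir c Z.limit lam →
        ∀ ξ : EuclideanSpace ℝ (Fin d),
          b * ((‖lam‖ + ‖ξ‖) * (√‖lam‖ + ‖ξ‖) ^ 2) ≤ ‖symbNAB σ m μ ν γ₁ γ₃ Z lam ξ‖ ∧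
          ContDiffAt ℝ ∞ (fun p : ℂ × EuclideanSpace ℝ (Fin d) =>
            (symbNAB σ m μ ν γ₁ γ₃ Z p.1 p.2)⁻¹) (lam, ξ)) ∧
      (∀ (κ : Fin d → ℕ) (k : ℕ), ∃ C : ℝ, 0 < C ∧
        ∀ (γ₁ γ₃ : ℝ) (Z : ZetaParam), ρ₁ ≤ γ₁ → γ₁ ≤ ρ₂ → |γ₃| ≤ ρ₃ →
        ∀ lam : ℂ, lam₀ ≤ ‖lam‖ ∧ ‖Z.limit‖ ≤ R ∧ AdmissibleDir c Z.limit lam →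
        ∀ ξ : EuclideanSpace ℝ (Fin d), ∀ ℓ ≤ k,
          ‖multiDeriv κ (fun η =>
              tauDeriv^[ℓ] (fun z => (symbNAB σ m μ ν γ₁ γ₃ Z z η)⁻¹) lam) ξ‖ ≤
            C * (‖lam‖ + ‖ξ‖)⁻¹ * ((√‖lam‖ + ‖ξ‖) ^ (2 + ∑ j, κ j))⁻¹) := by
  obtain ⟨δ, hδ, hδ₁, b, hb, lam₀, hlam₀, H⟩ :=
    exists_symbolLowerBound m R ρ₂ ρ₃ hc hσ hμ hν hρ₁
  refine ⟨lam₀, hlam₀, b, hb, fun d => ⟨?_, fun κ k => ?_⟩⟩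
  · intro γ₁ γ₃ Z h₁ h₂ h₃ lam ⟨hL, hR, hdir⟩ ξ
    have hlam : 0 < ‖lam‖ := by linarith
    have hlow := H γ₁ γ₃ Z h₁ h₂ h₃ hR lam hL hdir ‖ξ‖
    exact ⟨hlow.le_norm_symbNAB hδ (norm_pos_iff.1 hlam),
      hlow.contDiffAt_inv hδ (norm_pos_iff.1 hlam) (by positivity)⟩
  · set n := ∑ j, κ j with hn
    refine ⟨n.factorial * (n.factorial * (k.factorial * b⁻¹ * (4 / δ) ^ k) * (2 / δ) ^ n) * 2 ^ n,
      by positivity, ?_⟩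
    intro γ₁ γ₃ Z h₁ h₂ h₃ lam ⟨hL, hR, hdir⟩ ξ ℓ hℓ
    have hlam : lam ≠ 0 := norm_pos_iff.1 (by linarith)
    have hlow := H γ₁ γ₃ Z h₁ h₂ h₃ hR lam hL hdir ‖ξ‖
    have hone : 1 ≤ 4 / δ := (one_le_div hδ).2 (by linarith)
    refine (hlow.norm_multiDeriv_le hδ hδ₁ hlam hb κ hn.symm ℓ).trans ?_
    gcongr

end

theorem lemma3p10 (ε σ m μ ν ζ₀ ρ₁ ρ₂ ρ₃ : ℝ)
    (hε : 0 < ε) (hε' : ε < Real.pi / 2) (hσ : 0 < σ) (hm : 0 < m) (hμ : 0 < μ) (hν : 0 < ν)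
    (hρ₁ : 0 < ρ₁) (hρ₂ : 0 < ρ₂) (hρ₃ : 0 < ρ₃) :
    ∃ lam₀ : ℝ, 1 ≤ lam₀ ∧ ∃ c : ℝ, 0 < c ∧ ∀ N : ℕ, 2 ≤ N →
      -- `N(A,B)` is bounded below, and its inverse is a smooth function of `(λ, ξ')`
      (∀ (γ₁ γ₃ : ℝ) (Z : ZetaParam), ρ₁ ≤ γ₁ → γ₁ ≤ ρ₂ → 0 < γ₃ → γ₃ ≤ ρ₃ →
        Z.Admissible ε ζ₀ → ∀ lam ∈ Z.region ν ρ₃ ε lam₀,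
        ∀ ξ : EuclideanSpace ℝ (Fin (N - 1)), ξ ≠ 0 →
          c * ((‖lam‖ + ‖ξ‖) * (√‖lam‖ + ‖ξ‖) ^ 2) ≤ ‖symbNAB σ m μ ν γ₁ γ₃ Z lam ξ‖ ∧
          ContDiffAt ℝ ∞ (fun p : ℂ × EuclideanSpace ℝ (Fin (N - 1)) =>
            (symbNAB σ m μ ν γ₁ γ₃ Z p.1 p.2)⁻¹) (lam, ξ)) ∧
      -- the symbol estimate
      (∀ κ : Fin (N - 1) → ℕ, ∃ C : ℝ, 0 < C ∧
        ∀ (γ₁ γ₃ : ℝ) (Z : ZetaParam), ρ₁ ≤ γ₁ → γ₁ ≤ ρ₂ → 0 < γ₃ → γ₃ ≤ ρ₃ →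
        Z.Admissible ε ζ₀ → ∀ lam ∈ Z.region ν ρ₃ ε lam₀,
        ∀ ξ : EuclideanSpace ℝ (Fin (N - 1)), ξ ≠ 0 → ∀ ℓ : ℕ, ℓ ≤ 1 →
          ‖multiDeriv κ (fun η =>
              tauDeriv^[ℓ] (fun z => (symbNAB σ m μ ν γ₁ γ₃ Z z η)⁻¹) lam) ξ‖ ≤
            C * (‖lam‖ + ‖ξ‖)⁻¹ * ((√‖lam‖ + ‖ξ‖) ^ (2 + ∑ j, κ j))⁻¹) := by
  have hcos : Real.cos ε < 1 := by
    simpa using Real.cos_lt_cos_of_nonneg_of_le_pi_div_two le_rfl hε'.le hε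
  obtain ⟨lam₀, hlam₀, c, hc, H⟩ :=
    lemma3p10_general m (max ζ₀ 0) ρ₂ ρ₃ hcos hσ hμ hν hρ₁
  have hregion {Z : ZetaParam} (hZ : Z.Admissible ε ζ₀) {lam : ℂ}
      (hlam : lam ∈ Z.region ν ρ₃ ε lam₀) := hZ.of_mem_region hε (by linarith) hlam
  refine ⟨lam₀, hlam₀, c, hc, fun N _ => ⟨?_, fun κ => ?_⟩⟩
  · exact fun γ₁ γ₃ Z h₁ h₂ h₃ h₃' hZ lam hlam ξ _ =>
      (H (N - 1)).1 γ₁ γ₃ Z h₁ h₂ (by rwa [abs_of_pos h₃]) lam (hregion hZ hlam) ξ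
  · obtain ⟨C, hC, hest⟩ := (H (N - 1)).2 κ 1
    exact ⟨C, hC, fun γ₁ γ₃ Z h₁ h₂ h₃ h₃' hZ lam hlam ξ _ =>
      hest γ₁ γ₃ Z h₁ h₂ (by rwa [abs_of_pos h₃]) lam (hregion hZ hlam) ξ⟩
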